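/- Let $\boldsymbol\Omega=\{\Omega_i\}_{i=1}^m$ be a multi-region configuration in $\mathbb R^{n+1}$, contained in the interior of a compact region $\tilde\Omega$, with a bounded skeletal linking structure $\{(M_i,U_i,\ell_i)\}$. Here $M_i$ is the ($n$-dimensional, Whitney stratified) skeletal set of $\Omega_i$, $U_i=r_i\mathbf u_i$ is its multivalued radial vector field ($\mathbf u_i$ a unit field), and $\tilde M_i=\{(x,U): U \text{ a value of } U_i \text{ at } x\in M_i\}$ is the double of $M_i$. The functions $r_i\le \ell_i<\infty$ (radial and linking functions) and $\mathbf u_i$ are functions on $\tilde M_i$, the linking vectors $\ell_i\mathbf u_i$ being truncated at, or extended to, $\partial\tilde\Omega$, and $\tilde M_i$ has a refined stratification on whose strata $\ell_i$ is smooth and the linking flow is nonsingular. The linking flow is $\lambda_i(p,t)=x+\chi_i(p,t)\,\mathbf u_i(p)$ for $p\in\tilde M_i$ over $x$, where $\chi_i=2t\,r_i$ for $0\le t\le\frac12$ and $\chi_i=2(1-t)r_i+(2t-1)\ell_i$ for $\frac12\le t\le 1$. Let $M_{i\to j}\subset\tilde M_i$ be the union of the strata of $\tilde M_i$ which are linked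 to strata of $\tilde M_j$ (two different strata are linked if they have the same image under the time-one linking flow; $j=i$ is allowed), and let $M_{i\,\infty}$ be the union of the remaining (unlinked) strata of $\tilde M_i$. Put $$\Omega_{i\to j}=\lambda_i(M_{i\to j}\times[0,\tfrac12]),\quad \mathcal N_{i\to j}=\lambda_i(M_{i\to j}\times[\tfrac12,1]),\quad \Omega_{i\,\infty}=\lambda_i(M_{i\,\infty}\times[0,\tfrac12]),\quad \mathcal N_{i\,\infty}=\lambda_i(M_{i\,\infty}\times[\tfrac12,1]),$$ and $\mathcal N_i=\bigcup_{j\ne i}\mathcal N_{i\to j}$. Let $S_{rad}(w)=-\mathrm{proj}_U(\partial\mathbf u_i/\partial w)$ be the radial shape operator on $T_xM_i$ (with $\mathrm{proj}_U$ the projection onto $T_xM_i$ along $U$), let $\sigma_j$ be the $j$-th elementary symmetric function of its eigenvalues, and let $$\mathcal I(t)=\sum_{j=0}^n\frac{(-1)^j}{j+1}\sigma_j t^{j+1}=\int_0^t\det(I-\tau S_{rad})\,d\tau .$$ Let $dM$ be the skeletal measure on $\tilde M_i$: $dM=\rho\,dV$, where $dV$ is the $n$-dimensional Riemannian volume of the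 regular part of $M_i$ lifted to $\tilde M_i$ and $\rho=\mathbf u_i\cdot\mathbf n$, with $\mathbf n$ the unit normal on the same side as $U_i$; the singular part has measure zero. Then all the following regions are measurable with finite volume, all the integrands are integrable, and for all $i,j$: $$\mathrm{vol}(\mathcal N_{i\to j})=\int_{M_{i\to j}}\mathcal I(\ell_i)-\mathcal I(r_i)\,dM,\qquad \mathrm{vol}(\Omega_{i\to j})=\int_{M_{i\to j}}\mathcal I(r_i)\,dM,$$ $$\mathrm{vol}(\mathcal N_{i\,\infty})=\int_{M_{i\,\infty}}\mathcal I(\ell_i)-\mathcal I(r_i)\,dM,\qquad \mathrm{vol}(\Omega_{i\,\infty})=\int_{M_{i\,\infty}}\mathcal I(r_i)\,dM.$$ Consequently (generalized Weyl formula) $$\mathrm{vol}(\Omega_i)=\int_{\tilde M_i}\mathcal I(r_i)\,dM,$$ and (generalized Steiner formula) $$\mathrm{vol}(\mathcal N_i\cup\mathcal N_{i\to i}\cup\mathcal N_{i\,\infty})=\int_{\tilde M_i}\mathcal I(\ell_i)-\mathcal I(r_i)\,dM .$$ -/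

import Mathlib

open Set Filter Topology MeasureTheory
open scoped ContDiff

noncomputable section

namespace SkeletalLinking

/-- The Euclidean space `ℝᵏ`. -/
abbrev Euc (k : ℕ) : Type := EuclideanSpace ℝ (Fin k)

/-! ### Submanifolds and stratifications -/

/-- `g : V → S ∩ W` is a smooth local parametrization of `S` by the open set `V ⊆ ℝᵏ`.  The smooth
left inverse `h` on the open set `W` makes `g` an immersion and a homeomorphism onto `S ∩ W`. -/
structure IsChart {F : Type*} [NormedAddCommGroup F] [NormedSpace ℝ F] (k : ℕ) (S : Set F)
    (V : Set (Euc k)) (W : Set F) (g : Euc k → F) (h : F → Euc k) : Prop where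
  isOpen_source : IsOpen V
  isOpen_target : IsOpen W
  contDiffOn : ContDiffOn ℝ ∞ g V
  contDiffOn_inv : ContDiffOn ℝ ∞ h W
  image_eq : g '' V = S ∩ W
  left_inv : ∀ y ∈ V, h (g y) = y

/-- `S` is a smooth embedded `k`-dimensional submanifold (without boundary). -/
def IsSubmanifold {F : Type*} [NormedAddCommGroup F] [NormedSpace ℝ F] (k : ℕ) (S : Set F) : Prop :=
  ∀ p ∈ S, ∃ V W g h, IsChart k S V W g h ∧ p ∈ W

/-- `f` is smooth along the `k`-dimensional submanifold `S`. -/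
def SmoothAlong {F G : Type*} [NormedAddCommGroup F] [NormedSpace ℝ F] [NormedAddCommGroup G]
    [NormedSpace ℝ G] (k : ℕ) (S : Set F) (f : F → G) : Prop :=
  ∀ V W g h, IsChart k S V W g h → ContDiffOn ℝ ∞ (fun y => f (g y)) V

/-- For a flow `Φ (p, t)`, the map `Φ` on `S × I` is nonsingular (an immersion): in every local
parametrization of the submanifold `S`, the derivative in the point and in `t` is injective. -/
def NonsingularAlong {F G : Type*} [NormedAddCommGroup F] [NormedSpace ℝ F] [NormedAddCommGroup G]
    [NormedSpace ℝ G] (k : ℕ) (S : Set F) (I : Set ℝ) (Φ : F → ℝ → G) : Prop :=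
  ∀ V W g h, IsChart k S V W g h → ∀ y ∈ V, ∀ t ∈ I,
    Function.Injective (fderiv ℝ (fun z : Euc k × ℝ => Φ (g z.1) z.2) (y, t))

/-- The linear span of the tangent cone; at a point of a submanifold, and at a boundary or corner
point of a manifold with boundary and corners, this is the tangent space. -/
def tangentSpace {F : Type*} [NormedAddCommGroup F] [NormedSpace ℝ F] (X : Set F) (x : F) :
    Submodule ℝ F :=
  Submodule.span ℝ (tangentConeAt ℝ X x)

/-- Orthogonal projection of `ℝᵈ` onto the tangent space; limits of tangent spaces are limits of
these operators. -/
def tangentProj {d : ℕ} (X : Set (Euc d)) (x : Euc d) : Euc d →L[ℝ] Euc d :=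
  (tangentSpace X x).starProjection

/-- A finite stratification of `X`: a partition into smooth submanifolds which satisfies the axiom
of the frontier. -/
structure Stratification {F : Type*} [NormedAddCommGroup F] [NormedSpace ℝ F] (X : Set F) where
  strata : Set (Set F)
  dim : Set F → ℕ
  finite : strata.Finite
  sUnion_eq : ⋃₀ strata = X
  disjoint : ∀ S ∈ strata, ∀ T ∈ strata, S ≠ T → Disjoint S T
  smooth : ∀ S ∈ strata, IsSubmanifold (dim S) S
  frontier : ∀ S ∈ strata, ∀ T ∈ strata, S ≠ T → (S ∩ closure T).Nonempty →
    S ⊆ closure T ∧ dim S < dim T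

/-- Whitney's condition (b) for the pair `(X, Y)` (it implies condition (a)). -/
def WhitneyB {d : ℕ} (X Y : Set (Euc d)) : Prop :=
  ∀ y ∈ Y, ∀ a b : ℕ → Euc d, (∀ k, a k ∈ X) → (∀ k, b k ∈ Y) →
    Tendsto a atTop (𝓝 y) → Tendsto b atTop (𝓝 y) →
    ∀ (ξ : Euc d) (P : Euc d →L[ℝ] Euc d),
      Tendsto (fun k => ‖a k - b k‖⁻¹ • (a k - b k)) atTop (𝓝 ξ) →
      Tendsto (fun k => tangentProj X (a k)) atTop (𝓝 P) → P ξ = ξ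

/-- The model `C_k = ℝ₊ᵏ × ℝᵐ⁻ᵏ`. -/
def cornerModel (m k : ℕ) : Set (Euc m) := {y | ∀ i : Fin m, (i : ℕ) < k → 0 ≤ y i}

/-- `x` is a `k`-edge-corner point of `P`: near `x`, `P` is a `Cʳ` embedded `m`-manifold with
boundaries and corners, diffeomorphic to an open subset of `C_k` with `x ↦ 0`
(`k = 0` gives interior points, `k = 1` smooth boundary points). -/
def IsCornerPoint {d : ℕ} (r : WithTop ℕ∞) (m k : ℕ) (P : Set (Euc d)) (x : Euc d) : Prop :=
  k ≤ m ∧ ∃ (V : Set (Euc m)) (W : Set (Euc d)) (g : Euc m → Euc d) (h : Euc d → Euc m),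
    IsOpen V ∧ (0 : Euc m) ∈ V ∧ g 0 = x ∧ IsOpen W ∧ ContDiffOn ℝ r g V ∧ ContDiffOn ℝ r h W ∧
    MapsTo g V W ∧ g '' (V ∩ cornerModel m k) = P ∩ W ∧ ∀ y ∈ V, h (g y) = y

/-! ### Multi-region configurations -/

/-- The hyperplane `L_k = {y ∈ ℝᵏ⁺¹ : y₁ + ⋯ + y_{k+1} = 0}`. -/
def sumZero (k : ℕ) : Submodule ℝ (Euc (k + 1)) where
  carrier := {y | ∑ i, y i = 0}
  add_mem' {a b} ha hb := by
    simp only [mem_ofPred_eq] at ha hb ⊢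
    simp [Finset.sum_add_distrib, ha, hb]
  zero_mem' := by simp
  smul_mem' c a ha := by
    simp only [mem_ofPred_eq] at ha ⊢
    simp [← Finset.mul_sum, ha]

/-- The local model `P_k = Y_k × ℝˡ` in `L_k × ℝˡ`, where `k + l = n + 1`. -/
def modelP (k l : ℕ) : Set (sumZero k × Euc l) :=
  {z | ∃ i j, i ≠ j ∧ (z.1 : Euc (k + 1)) i = (z.1 : Euc (k + 1)) j ∧
    ∀ m, m ≠ i → m ≠ j → (z.1 : Euc (k + 1)) j ≤ (z.1 : Euc (k + 1)) m}

/-- The local model `Q_k`: the hyperplane on which the last coordinate vanishes, with the part of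
`P_k` on which the last coordinate is nonnegative. -/
def modelQ (k l : ℕ) : Set (sumZero k × Euc (l + 1)) :=
  {z | z.2 (Fin.last l) = 0} ∪ {z | 0 ≤ z.2 (Fin.last l) ∧ z ∈ modelP k (l + 1)}

/-- Near `x`, the set `B` is diffeomorphic (by an ambient local diffeomorphism with `x ↦ 0`) to the
model `Q`. -/
def LocallyDiffeoTo {F G : Type*} [NormedAddCommGroup F] [NormedSpace ℝ F] [NormedAddCommGroup G]
    [NormedSpace ℝ G] (B : Set F) (x : F) (Q : Set G) : Prop :=
  ∃ e : OpenPartialHomeomorph F G, x ∈ e.source ∧ e x = 0 ∧ ContDiffOn ℝ ∞ e e.source ∧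
    ContDiffOn ℝ ∞ e.symm e.target ∧ e '' (B ∩ e.source) = Q ∩ e.target

/-- A configuration of `m` regions in `ℝⁿ⁺¹`. -/
structure MultiRegionConfiguration (n m : ℕ) where
  region : Fin m → Set (Euc (n + 1))
  compact : ∀ i, IsCompact (region i)
  connected : ∀ i, IsConnected (region i)
  /-- Each region is an `(n+1)`-dimensional smooth manifold with boundaries and corners. -/
  corners : ∀ i, ∀ x ∈ region i, ∃ k, IsCornerPoint ∞ (n + 1) k (region i) x
  /-- Boundary intersection condition: two regions meet only on their boundaries ... -/
  inter_subset : ∀ i j, i ≠ j → region i ∩ region j ⊆ frontier (region i) ∩ frontier (region j)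
  /-- ... in a union of strata which form the closure of open boundary strata. -/
  inter_strata : ∀ i j, i ≠ j → region i ∩ region j ⊆
    closure {x ∈ region i ∩ region j |
      IsCornerPoint ∞ (n + 1) 1 (region i) x ∧ IsCornerPoint ∞ (n + 1) 1 (region j) x}
  /-- Boundary edge condition: at a point of more than one region, the union of the boundaries of
  the regions containing the point is locally diffeomorphic to some `P_k`, `1 ≤ k ≤ n + 1`, or to
  some `Q_k`, `1 ≤ k ≤ n`. -/
  edge_condition : ∀ i j, i ≠ j → ∀ x ∈ region i ∩ region j,
    (∃ k l, 1 ≤ k ∧ k + l = n + 1 ∧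
      LocallyDiffeoTo (⋃ q ∈ {q | x ∈ region q}, frontier (region q)) x (modelP k l)) ∨
    (∃ k l, 1 ≤ k ∧ k + (l + 1) = n + 1 ∧
      LocallyDiffeoTo (⋃ q ∈ {q | x ∈ region q}, frontier (region q)) x (modelQ k l))

/-- `𝓑_{i 0}`: the part of the boundary of the `i`-th region not shared with another region. -/
def MultiRegionConfiguration.unsharedBoundary {n m : ℕ} (Ω : MultiRegionConfiguration n m)
    (i : Fin m) : Set (Euc (n + 1)) :=
  frontier (Ω.region i) \ ⋃ j ∈ {j | j ≠ i}, frontier (Ω.region j)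

/-! ### Skeletal sets and skeletal structures -/

/-- The edge points `∂M` of an `n`-dimensional set: `M` is locally a manifold with boundary. -/
def edgePoints {d : ℕ} (n : ℕ) (M : Set (Euc d)) : Set (Euc d) :=
  {x ∈ M | IsCornerPoint 1 n 1 M x}

/-- `Ps` is a paving of the neighbourhood `M ∩ W` of `x₀` by finitely many `n`-manifolds with
boundaries and corners that meet only on their boundaries; those which meet `∂M` do so in
`(n-1)`-dimensional facets. -/
structure IsPaving {d : ℕ} (n : ℕ) (M : Set (Euc d)) (x₀ : Euc d) (W : Set (Euc d))
    (Ps : Set (Set (Euc d))) : Prop where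
  isOpen : IsOpen W
  mem : x₀ ∈ W
  finite : Ps.Finite
  cover : ⋃₀ Ps = M ∩ W
  mem_piece : ∀ P ∈ Ps, x₀ ∈ P
  corners : ∀ P ∈ Ps, ∀ x ∈ P, ∃ k, IsCornerPoint 1 n k P x
  facets : ∀ P ∈ Ps, ∀ Q ∈ Ps, P ≠ Q → ∀ x ∈ P ∩ Q,
    ¬ IsCornerPoint 1 n 0 P x ∧ ¬ IsCornerPoint 1 n 0 Q x
  edge_facets : x₀ ∈ closure (edgePoints n M) → ∀ P ∈ Ps,
    P ∩ edgePoints n M ⊆ closure ({x ∈ P | IsCornerPoint 1 n 1 P x} ∩ edgePoints n M)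

/-- An `n`-dimensional skeletal set in `ℝⁿ⁺¹`. -/
structure SkeletalSet (n : ℕ) where
  carrier : Set (Euc (n + 1))
  compact : IsCompact carrier
  strat : Stratification carrier
  whitney : ∀ S ∈ strat.strata, ∀ T ∈ strat.strata, S ≠ T → WhitneyB S T
  dim_le : ∀ S ∈ strat.strata, strat.dim S ≤ n
  /-- At singular points, each local component of the regular part has a unique limiting tangent
  space. -/
  limit_tangent : ∀ x₀ ∈ carrier \ ⋃₀ {S ∈ strat.strata | strat.dim S = n}, ∃ ε > 0,
    ∀ y ∈ (⋃₀ {S ∈ strat.strata | strat.dim S = n}) ∩ Metric.ball x₀ ε,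
      ∃ P : Euc (n + 1) →L[ℝ] Euc (n + 1),
        Tendsto (tangentProj carrier) (𝓝[connectedComponentIn
          ((⋃₀ {S ∈ strat.strata | strat.dim S = n}) ∩ Metric.ball x₀ ε) y] x₀) (𝓝 P)
  paved : ∀ x₀ ∈ carrier \ ⋃₀ {S ∈ strat.strata | strat.dim S = n},
    ∃ W Ps, IsPaving n carrier x₀ W Ps

/-- `M_reg`: the union of the `n`-dimensional strata. -/
def SkeletalSet.reg {n : ℕ} (M : SkeletalSet n) : Set (Euc (n + 1)) :=
  ⋃₀ {S ∈ M.strat.strata | M.strat.dim S = n}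

/-- `M_sing`: the union of the other strata. -/
def SkeletalSet.sing {n : ℕ} (M : SkeletalSet n) : Set (Euc (n + 1)) := M.carrier \ M.reg

/-- `∂M`. -/
def SkeletalSet.edge {n : ℕ} (M : SkeletalSet n) : Set (Euc (n + 1)) := edgePoints n M.carrier

/-- The vector `v` at `x` points into `C`. -/
def PointsInto {d : ℕ} (C : Set (Euc d)) (x v : Euc d) : Prop :=
  ∀ᶠ t in 𝓝[>] (0 : ℝ), x + t • v ∈ C

/-- `f` is a smooth value, near `x ∈ M`, of the multivalued vector field on `M` with graph `D`. -/
def IsSmoothValue {d : ℕ} (M : Set (Euc d)) (D : Set (Euc d × Euc d)) (x : Euc d)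
    (f : Euc d → Euc d) : Prop :=
  ContDiffAt ℝ ∞ f x ∧ ∀ᶠ y in 𝓝[M] x, (y, f y) ∈ D

/-- A skeletal structure `(M, U)` in `ℝⁿ⁺¹`.  The multivalued radial vector field `U` is given by
its graph, the double `M̃ = {(x, v) : v is a value of U at x}`, with the subspace topology. -/
structure SkeletalStructure (n : ℕ) extends SkeletalSet n where
  double : Set (Euc (n + 1) × Euc (n + 1))
  fst_image_double : Prod.fst '' double = carrier
  double_compact : IsCompact double
  finite_fiber : ∀ x, {v | (x, v) ∈ double}.Finite
  ne_zero : ∀ p ∈ double, p.2 ≠ 0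
  /-- At regular points there are two smooth values, pointing to opposite sides of `M`. -/
  two_sided : ∀ x ∈ toSkeletalSet.reg, ∃ f₁ f₂,
    IsSmoothValue carrier double x f₁ ∧ IsSmoothValue carrier double x f₂ ∧
    (∀ᶠ y in 𝓝[carrier] x, {v | (y, v) ∈ double} = {f₁ y, f₂ y}) ∧
    ∃ ν ∈ (tangentSpace carrier x)ᗮ, 0 < inner ℝ (f₁ x) ν ∧ inner ℝ (f₂ x) ν < 0
  /-- Near singular points, both values extend over the pieces of a paving, to values that are
  transverse to the pieces away from `∂M`. -/
  extension : ∀ x₀ ∈ toSkeletalSet.sing, ∃ W Ps, IsPaving n carrier x₀ W Ps ∧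
    ∀ P ∈ Ps, ∃ a₁ a₂ : Euc (n + 1) → Euc (n + 1), ContinuousOn a₁ P ∧ ContinuousOn a₂ P ∧
      (∀ y ∈ P, (y, a₁ y) ∈ double ∧ (y, a₂ y) ∈ double) ∧
      (∀ y ∈ P ∩ toSkeletalSet.reg, {v | (y, v) ∈ double} = {a₁ y, a₂ y}) ∧
      (P ∩ toSkeletalSet.edge = ∅ →
        a₁ x₀ ∉ tangentSpace P x₀ ∧ a₂ x₀ ∉ tangentSpace P x₀)
  /-- At singular points off `∂M`, exactly one value points into each local complementary
  component, and the nearby values pointing into this component converge to it. -/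
  components : ∀ x₀ ∈ toSkeletalSet.sing, x₀ ∉ toSkeletalSet.edge → ∃ ε > 0,
    ∀ y ∈ Metric.ball x₀ ε \ carrier,
      x₀ ∈ closure (connectedComponentIn (Metric.ball x₀ ε \ carrier) y) →
      ∃ v, (x₀, v) ∈ double ∧
        PointsInto (connectedComponentIn (Metric.ball x₀ ε \ carrier) y) x₀ v ∧
        (∀ w, (x₀, w) ∈ double →
          PointsInto (connectedComponentIn (Metric.ball x₀ ε \ carrier) y) x₀ w → w = v) ∧
        Tendsto Prod.snd (comap Prod.fst (𝓝 x₀) ⊓ 𝓟 {p ∈ double |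
          PointsInto (connectedComponentIn (Metric.ball x₀ ε \ carrier) y) p.1 p.2}) (𝓝 v)
  /-- At edge points there is a unique value; it is tangent to `M` and points away from `M`. -/
  edge_value : ∀ x₀ ∈ toSkeletalSet.edge, ∃ v, (∀ w, (x₀, w) ∈ double ↔ w = v) ∧
    v ∈ tangentSpace carrier x₀ ∧ v ∉ posTangentConeAt carrier x₀

/-- `(M, U)` is a skeletal structure for the region `R`: the radial flow `x + t U(x)`, `0 < t ≤ 1`,
is a bijection from `M̃ × (0, 1]` to `R \ M`, and its time-one map has the boundary of `R` as its
image. -/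
structure SkeletalStructure.IsFor {n : ℕ} (s : SkeletalStructure n) (R : Set (Euc (n + 1))) :
    Prop where
  region_eq : R = {z | ∃ p ∈ s.double, ∃ t ∈ Icc (0 : ℝ) 1, z = p.1 + t • p.2}
  frontier_eq : frontier R = {z | ∃ p ∈ s.double, z = p.1 + p.2}
  injective : ∀ p ∈ s.double, ∀ q ∈ s.double, ∀ a ∈ Ioc (0 : ℝ) 1, ∀ b ∈ Ioc (0 : ℝ) 1,
    p.1 + a • p.2 = q.1 + b • q.2 → p = q ∧ a = b
  avoids : ∀ p ∈ s.double, ∀ t ∈ Ioc (0 : ℝ) 1, p.1 + t • p.2 ∉ s.carrier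

/-! ### Radial geometry and the skeletal measure -/

/-- The unit vector `u` of the radial vector at a point `p = (x, U)` of the double. -/
def unitVec {d : ℕ} (p : Euc d × Euc d) : Euc d := ‖p.2‖⁻¹ • p.2

namespace SkeletalStructure

variable {n : ℕ} (s : SkeletalStructure n)

/-- The part of `M̃` lying over `M_reg`. -/
def doubleReg : Set (Euc (n + 1) × Euc (n + 1)) := {p ∈ s.double | p.1 ∈ s.reg}

/-- The tangent space of `M` at the base point of `p`. -/
def baseTangent (p : Euc (n + 1) × Euc (n + 1)) : Submodule ℝ (Euc (n + 1)) :=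
  tangentSpace s.carrier p.1

/-- A smooth value of `U` at `p = (x, v)`, `x ∈ M_reg`, that is equal to `v` at `x` (any two agree
on `M` near `x`). -/
def smoothValue (p : Euc (n + 1) × Euc (n + 1)) : Euc (n + 1) → Euc (n + 1) :=
  Classical.epsilon fun f => IsSmoothValue s.carrier s.double p.1 f ∧ f p.1 = p.2

open Classical in
/-- The radial shape operator `S_rad(w) = -proj_U(∂u/∂w)` on `T_x M`, where `u` is the unit vector
field of the smooth value of `U` and `proj_U` is the projection onto `T_x M` along `U`. -/
def radialShape (p : Euc (n + 1) × Euc (n + 1)) : s.baseTangent p →ₗ[ℝ] s.baseTangent p :=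
  if hc : IsCompl (s.baseTangent p) (Submodule.span ℝ {p.2}) then
    -((s.baseTangent p).projectionOnto (Submodule.span ℝ {p.2}) hc ∘ₗ
      (fderiv ℝ (fun y => ‖s.smoothValue p y‖⁻¹ • s.smoothValue p y) p.1).toLinearMap ∘ₗ
      (s.baseTangent p).subtype)
  else 0

/-- The principal radial curvatures: the eigenvalues of `S_rad`, with multiplicity. -/
def principalCurvatures (p : Euc (n + 1) × Euc (n + 1)) : Multiset ℂ :=
  ((s.radialShape p).charpoly.map (algebraMap ℝ ℂ)).roots

/-- `σ_j`: the `j`-th elementary symmetric function of the principal radial curvatures. -/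
def sigma (j : ℕ) (p : Euc (n + 1) × Euc (n + 1)) : ℝ := ((s.principalCurvatures p).esymm j).re

/-- `𝓘(t) = ∑_{j=0}^{n} (-1)ʲ σ_j tʲ⁺¹ / (j + 1)` at the point `p`. -/
def calI (p : Euc (n + 1) × Euc (n + 1)) (t : ℝ) : ℝ :=
  ∑ j ∈ Finset.range (n + 1), (-1) ^ j / ((j : ℝ) + 1) * s.sigma j p * t ^ (j + 1)

/-- The unit normal to `M` on the side into which `U` points. -/
def unitNormal (p : Euc (n + 1) × Euc (n + 1)) : Euc (n + 1) :=
  ‖unitVec p - (s.baseTangent p).starProjection (unitVec p)‖⁻¹ •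
    (unitVec p - (s.baseTangent p).starProjection (unitVec p))

/-- `ρ = u · n`. -/
def rho (p : Euc (n + 1) × Euc (n + 1)) : ℝ := inner ℝ (unitVec p) (s.unitNormal p)

/-- The skeletal measure `dM = ρ dV` on `M̃`, where `dV` is the `n`-dimensional Riemannian volume of
`M`, lifted to `M̃`; the part of `M̃` over `M_sing` has measure zero.  In a local parametrization `g`
of the regular part of `M̃`, `dV` is `normDet(D(π ∘ g)) dy`.  The resulting measures on the charts
agree on overlaps, so that their supremum is the Borel measure which they define together. -/
def skeletalMeasure : Measure (Euc (n + 1) × Euc (n + 1)) :=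
  sSup {μ | ∃ V W g h, IsChart n s.doubleReg V W g h ∧
    μ = ((volume.restrict V).withDensity fun y =>
      ENNReal.ofReal (s.rho (g y) *
        (fderiv ℝ (fun z => (g z).1) y).toLinearMap.normDet)).map g}

end SkeletalStructure

/-! ### The linking flow and bounded skeletal linking structures -/

/-- The linking flow for `0 ≤ t ≤ 1/2`, i.e. the radial flow at double speed. -/
def flowInt {d : ℕ} (p : Euc d × Euc d) (t : ℝ) : Euc d := p.1 + (2 * t * ‖p.2‖) • unitVec p

/-- The linking flow for `1/2 ≤ t ≤ 1`. -/
def flowExt {d : ℕ} (ℓ : Euc d × Euc d → ℝ) (p : Euc d × Euc d) (t : ℝ) : Euc d :=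
  p.1 + (2 * (1 - t) * ‖p.2‖ + (2 * t - 1) * ℓ p) • unitVec p

/-- The linking flow `λ(p, t) = x + χ(p, t) u`. -/
def linkingFlow {d : ℕ} (ℓ : Euc d × Euc d → ℝ) (p : Euc d × Euc d) (t : ℝ) : Euc d :=
  if t ≤ 1 / 2 then flowInt p t else flowExt ℓ p t

/-- The image `W = {x + L(x)}` of a stratum under the linking flow at time `1`. -/
def linkImage {d : ℕ} (ℓ : Euc d × Euc d → ℝ) (S : Set (Euc d × Euc d)) : Set (Euc d) :=
  (fun p => linkingFlow ℓ p 1) '' S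

/-- A bounded skeletal linking structure for the configuration `Ω` in the interior of the compact
region `Ωt`.  The linking functions `ℓ i` are defined on the doubles `M̃_i`, they are truncated or
extended at the boundary of `Ωt`, and hence finite. -/
structure BoundedSkeletalLinkingStructure {n m : ℕ} (Ω : MultiRegionConfiguration n m)
    (Ωt : Set (Euc (n + 1))) where
  compact : IsCompact Ωt
  region_subset : ∀ i, Ω.region i ⊆ interior Ωt
  /-- Each `(M_i, U_i)` is a skeletal structure for the region `Ω_i`. -/
  skel : Fin m → SkeletalStructure n
  isFor : ∀ i, (skel i).IsFor (Ω.region i)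
  /-- The linking functions, one value for each value of `U_i`, with `ℓ_i ≥ r_i`. -/
  ℓ : Fin m → Euc (n + 1) × Euc (n + 1) → ℝ
  le_ℓ : ∀ i, ∀ p ∈ (skel i).double, ‖p.2‖ ≤ ℓ i p
  /-- The labelled refinement of the stratification of `M̃_i`, whose strata are those over the
  strata of `M_i`. -/
  refinement : ∀ i, Stratification (skel i).double
  refines : ∀ i, ∀ S ∈ (refinement i).strata, ∃ R ∈ (skel i).strat.strata, Prod.fst '' S ⊆ R
  proj_immersion : ∀ i, ∀ S ∈ (refinement i).strata, ∀ p ∈ S,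
    ∀ w ∈ tangentSpace S p, w.1 = 0 → w = 0
  /-- Continuity of `ℓ_i`, and smoothness on the strata. -/
  ℓ_continuous : ∀ i, ContinuousOn (ℓ i) (skel i).double
  ℓ_smooth : ∀ i, ∀ S ∈ (refinement i).strata, SmoothAlong ((refinement i).dim S) S (ℓ i)
  /-- Nonsingularity of the linking flow on each stratum: first on `(0, 1/2]`, and then on
  `[1/2, 1]` if the stratum corresponds to unshared boundary; on the other strata `ℓ = r`. -/
  nonsingular_int : ∀ i, ∀ S ∈ (refinement i).strata,
    NonsingularAlong ((refinement i).dim S) S (Ioc 0 (1 / 2)) flowInt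
  nonsingular_ext : ∀ i, ∀ S ∈ (refinement i).strata,
    ((∀ p ∈ S, p.1 + p.2 ∈ Ω.unsharedBoundary i) ∧
      NonsingularAlong ((refinement i).dim S) S (Icc (1 / 2) 1) (flowExt (ℓ i))) ∨
    ((∀ p ∈ S, p.1 + p.2 ∉ Ω.unsharedBoundary i) ∧ ∀ p ∈ S, ℓ i p = ‖p.2‖)
  /-- The flow lines, without their endpoints on the skeletal sets and on the linking axis, are
  disjoint, and beyond the boundaries they are external to the configuration. -/
  flow_injective : ∀ i j, ∀ p ∈ (skel i).double, ∀ q ∈ (skel j).double,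
    ∀ a ∈ Ioo 0 (ℓ i p), ∀ b ∈ Ioo 0 (ℓ j q),
      p.1 + a • unitVec p = q.1 + b • unitVec q → i = j ∧ p = q ∧ a = b
  flow_external : ∀ i j, ∀ p ∈ (skel i).double, ∀ a ∈ Ioo ‖p.2‖ (ℓ i p),
    p.1 + a • unitVec p ∉ Ω.region j
  /-- On each stratum the linking flow at time `1` is one-to-one. -/
  link_injOn : ∀ i, ∀ S ∈ (refinement i).strata, InjOn (fun p => linkingFlow (ℓ i) p 1) S
  /-- The images of the strata at time `1` are smooth, they are equal or disjoint, and
  they are the strata of a stratified set, the linking axis (with the points of `∂Ωt` at which the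
  flow ends). -/
  axis : Stratification (⋃ i, linkImage (ℓ i) (skel i).double)
  axis_strata : axis.strata = {W | ∃ i, ∃ S ∈ (refinement i).strata, W = linkImage (ℓ i) S}
  /-- The flow stays in the interior of `Ωt` until it ends in `Ωt`; each stratum either ends in
  the interior or is truncated at the boundary. -/
  flow_interior : ∀ i, ∀ p ∈ (skel i).double, ∀ a ∈ Ico 0 (ℓ i p),
    p.1 + a • unitVec p ∈ interior Ωt
  flow_end : ∀ i, ∀ p ∈ (skel i).double, linkingFlow (ℓ i) p 1 ∈ Ωt
  truncation : ∀ i, ∀ S ∈ (refinement i).strata,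
    linkImage (ℓ i) S ⊆ interior Ωt ∨ linkImage (ℓ i) S ⊆ frontier Ωt
  /-- The flow from `n`-dimensional strata without linking is extended to, or truncated at, the
  boundary of `Ωt`. -/
  unlinked_end : ∀ i, ∀ S ∈ (refinement i).strata, (refinement i).dim S = n →
    (∀ j, ∀ T ∈ (refinement j).strata, linkImage (ℓ i) S = linkImage (ℓ j) T → i = j ∧ S = T) →
    linkImage (ℓ i) S ⊆ frontier Ωt

namespace BoundedSkeletalLinkingStructure

variable {n m : ℕ} {Ω : MultiRegionConfiguration n m} {Ωt : Set (Euc (n + 1))}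
  (L : BoundedSkeletalLinkingStructure Ω Ωt)

/-- The stratum `S` of `M̃_i` is linked to the (different) stratum `T` of `M̃_j`: the linking flow
ends on the same stratum of the linking axis. -/
def LinkedStrata (i : Fin m) (S : Set (Euc (n + 1) × Euc (n + 1))) (j : Fin m)
    (T : Set (Euc (n + 1) × Euc (n + 1))) : Prop :=
  (i ≠ j ∨ S ≠ T) ∧ linkImage (L.ℓ i) S = linkImage (L.ℓ j) T

/-- `M_{i → j}`: the union of the strata of `M̃_i` which are linked to strata of `M̃_j`. -/
def linked (i j : Fin m) : Set (Euc (n + 1) × Euc (n + 1)) :=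
  ⋃₀ {S ∈ (L.refinement i).strata | ∃ T ∈ (L.refinement j).strata, L.LinkedStrata i S j T}

/-- `M_{i ∞}`: the union of the remaining, unlinked, strata of `M̃_i`. -/
def unlinked (i : Fin m) : Set (Euc (n + 1) × Euc (n + 1)) :=
  ⋃₀ {S ∈ (L.refinement i).strata |
    ∀ j, ∀ T ∈ (L.refinement j).strata, ¬ L.LinkedStrata i S j T}

/-- The image of `A × [0, 1/2]` under the linking flow `λ_i`. -/
def innerImage (i : Fin m) (A : Set (Euc (n + 1) × Euc (n + 1))) : Set (Euc (n + 1)) :=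
  {z | ∃ p ∈ A, ∃ t ∈ Icc (0 : ℝ) (1 / 2), z = linkingFlow (L.ℓ i) p t}

/-- The image of `A × [1/2, 1]` under the linking flow `λ_i`. -/
def outerImage (i : Fin m) (A : Set (Euc (n + 1) × Euc (n + 1))) : Set (Euc (n + 1)) :=
  {z | ∃ p ∈ A, ∃ t ∈ Icc (1 / 2 : ℝ) 1, z = linkingFlow (L.ℓ i) p t}

/-- `Ω_{i → j}`: the region of `Ω_i` linked to `Ω_j`. -/
def linkedRegion (i j : Fin m) : Set (Euc (n + 1)) := L.innerImage i (L.linked i j)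

/-- `𝓝_{i → j}`: the linking neighbourhood of `Ω_i` linked to `Ω_j`. -/
def linkingNhd (i j : Fin m) : Set (Euc (n + 1)) := L.outerImage i (L.linked i j)

/-- `Ω_{i ∞}`. -/
def unlinkedRegion (i : Fin m) : Set (Euc (n + 1)) := L.innerImage i (L.unlinked i)

/-- `𝓝_{i ∞}`. -/
def unlinkedNhd (i : Fin m) : Set (Euc (n + 1)) := L.outerImage i (L.unlinked i)

/-- `𝓝_i = ⋃_{j ≠ i} 𝓝_{i → j}`: the total linking neighbourhood. -/
def totalLinkingNhd (i : Fin m) : Set (Euc (n + 1)) := ⋃ j ∈ {j | j ≠ i}, L.linkingNhd i j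

/-- `𝓝_i ∪ 𝓝_{i → i} ∪ 𝓝_{i ∞}`: the total neighbourhood of `Ω_i`. -/
def totalNhd (i : Fin m) : Set (Euc (n + 1)) :=
  L.totalLinkingNhd i ∪ L.linkingNhd i i ∪ L.unlinkedNhd i

/-- The function `𝓘(r_i)` on `M̃_i`. -/
def innerIntegrand (i : Fin m) (p : Euc (n + 1) × Euc (n + 1)) : ℝ := (L.skel i).calI p ‖p.2‖

/-- The function `𝓘(ℓ_i) - 𝓘(r_i)` on `M̃_i`. -/
def outerIntegrand (i : Fin m) (p : Euc (n + 1) × Euc (n + 1)) : ℝ :=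
  (L.skel i).calI p (L.ℓ i p) - (L.skel i).calI p ‖p.2‖

end BoundedSkeletalLinkingStructure

/-- The set `R` is measurable with finite volume, `f` is integrable on `A`, and
`vol(R) = ∫_A f dμ`. -/
def HasVolumeIntegral {d : ℕ} {X : Type*} [MeasurableSpace X] (R : Set (Euc d)) (A : Set X)
    (f : X → ℝ) (μ : Measure X) : Prop :=
  MeasurableSet R ∧ volume R < ⊤ ∧ IntegrableOn f A μ ∧ volume.real R = ∫ p in A, f p ∂μ

end SkeletalLinking

end

noncomputable section

namespace SkeletalLinking

/-! ### Linear algebra -/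

section LinearAlgebra

open Module

/-! Every region in the theorem is a tube over a union of strata of `M̃_i`: the points x + τu with α
≤ τ ≤ β, where (α, β) is (0, r) for the inner regions and (r, ℓ) for the outer ones. All the
formulas are therefore instances of one statement about an arbitrary family of strata,
`hasVolumeIntegral_closedTube`.

In a chart of the regular double, the map (y, τ) ↦ x(y) + τ u(y) has Jacobian |det(I - τ S_rad)|
times the density of dM (`normDet_flowDeriv`): the normal component of u gives the factor ρ, and the
variation of u along M gives the determinant. Nonsingularity of the linking flow keeps this
determinant away from zero on (0, ℓ]; it is 1 at τ = 0, so it is positive up to ℓ (`det_pos`) and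
the absolute value can be dropped. Its integral over τ is then 𝓘(β) - 𝓘(α). Distinct flow lines are
disjoint, so the map is injective, and change of variables with Tonelli gives the volume of the open
tube over the n-dimensional strata (`volume_tube`). The skeletal measure enters through
`restrict_skeletalMeasure`: the chart measures agree on overlaps, so on the image of a chart their
supremum is the measure of that chart.

What is left of the closed tube is null: lines over strata of dimension k < n sweep out dimension k
+ 1 < n + 1, and the endpoints over n-dimensional strata form images of n-dimensional charts. The
volume is finite because the flow stays in the compact region, and the integrand, nonnegative on the
n-dimensional strata, is integrable because its integral is this volume. -/

theorem det_id_sub_smul_eq_sum {T : Type*} [AddCommGroup T] [Module ℝ T] [FiniteDimensional ℝ T]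
    {n : ℕ} (hn : finrank ℝ T = n) (S : T →ₗ[ℝ] T) (τ : ℝ) :
    LinearMap.det (LinearMap.id - τ • S) = ∑ j ∈ Finset.range (n + 1),
      (-1) ^ j * (((S.charpoly.map (algebraMap ℝ ℂ)).roots.esymm j).re) * τ ^ j := by
  classical
  set b := finBasisOfFinrankEq ℝ T hn
  set A := LinearMap.toMatrix b b S with hA
  have hdeg : S.charpoly.natDegree = n := by rw [LinearMap.charpoly_natDegree, hn]
  have hdegC : (S.charpoly.map (algebraMap ℝ ℂ)).natDegree = n := by
    rw [Polynomial.natDegree_map, hdeg]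
  -- Vieta's formula over ℂ, where the polynomial splits; the coefficient is real, so taking real
  -- parts loses nothing.
  have hcoeff : ∀ j ≤ n, S.charpoly.coeff (n - j) =
      (-1) ^ j * ((S.charpoly.map (algebraMap ℝ ℂ)).roots.esymm j).re := by
    intro j hj
    have h1 := Polynomial.coeff_eq_esymm_roots_of_card
      (p := S.charpoly.map (algebraMap ℝ ℂ)) (k := n - j)
      ((IsAlgClosed.splits _).natDegree_eq_card_roots.symm) (by omega)
    rw [hdegC, Nat.sub_sub_self hj, (S.charpoly_monic.map _).leadingCoeff, one_mul,
      Polynomial.coeff_map] at h1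
    have h2 := congrArg Complex.re h1
    rw [show ((-1 : ℂ)) ^ j = (((-1 : ℝ) ^ j : ℝ) : ℂ) by push_cast; rfl,
      Complex.re_ofReal_mul] at h2
    simpa using h2
  -- The determinant of 1 - τA is the reversed characteristic polynomial, so its τ^j coefficient is
  -- the one of degree n - j.
  have hdet : LinearMap.det (LinearMap.id - τ • S) = A.charpolyRev.eval τ := by
    rw [← LinearMap.det_toMatrix b, map_sub, map_smul, LinearMap.toMatrix_id, ← hA,
      Matrix.charpolyRev, ← Polynomial.coe_evalRingHom, RingHom.map_det]
    congr 1
    ext i j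
    by_cases h : i = j <;> simp [h] <;> ring
  have hrev : A.charpolyRev = S.charpoly.reverse := by
    rw [← Matrix.reverse_charpoly, hA, LinearMap.charpoly_toMatrix]
  rw [hdet, hrev, Polynomial.eval_eq_sum_range' (n := n + 1)
    (by have := Polynomial.reverse_natDegree_le S.charpoly; omega)]
  refine Finset.sum_congr rfl fun j hj => ?_
  have hj' : j ≤ n := by simpa [Nat.lt_succ_iff] using hj
  rw [Polynomial.coeff_reverse, hdeg, Polynomial.revAt_le hj', hcoeff j hj']

/-- Sylvester's identity moves a determinant from the ambient space to a smaller one: to a line for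
the factor ρ, and to the tangent space for the shape operator. -/
theorem det_id_add_comp_comm {E T : Type*} [AddCommGroup E] [Module ℝ E] [FiniteDimensional ℝ E]
    [AddCommGroup T] [Module ℝ T] [FiniteDimensional ℝ T] (A : T →ₗ[ℝ] E) (B : E →ₗ[ℝ] T) :
    LinearMap.det (LinearMap.id + A ∘ₗ B) = LinearMap.det (LinearMap.id + B ∘ₗ A) := by
  classical
  have bE := finBasis ℝ E
  have bT := finBasis ℝ T
  rw [← LinearMap.det_toMatrix bE, ← LinearMap.det_toMatrix bT, map_add, map_add,
    LinearMap.toMatrix_id, LinearMap.toMatrix_id, LinearMap.toMatrix_comp bE bT bE,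
    LinearMap.toMatrix_comp bT bE bT, Matrix.det_one_add_mul_comm]

variable {P E : Type*} [NormedAddCommGroup P] [InnerProductSpace ℝ P]
  [NormedAddCommGroup E] [InnerProductSpace ℝ E]

/-- The linear map `(v, c) ↦ X v + c • e`. -/
def appendVec (X : P →ₗ[ℝ] E) (e : E) : WithLp 2 (P × ℝ) →ₗ[ℝ] E :=
  (X.coprod (LinearMap.toSpanSingleton ℝ E e)) ∘ₗ (WithLp.linearEquiv 2 ℝ (P × ℝ)).toLinearMap

theorem appendVec_apply (X : P →ₗ[ℝ] E) (e : E) (w : WithLp 2 (P × ℝ)) :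
    appendVec X e w = X w.fst + w.snd • e := by
  simp [appendVec]

variable [FiniteDimensional ℝ P] [FiniteDimensional ℝ E]

omit [FiniteDimensional ℝ E] in
-- A unit vector orthogonal to the range makes the Gram matrix block diagonal, with an extra block
-- 1.
theorem normDet_appendVec_unit_normal (X : P →ₗ[ℝ] E) {e : E} (he : ‖e‖ = 1)
    (horth : ∀ v, inner ℝ (X v) e = 0) : (appendVec X e).normDet = X.normDet := by
  classical
  have horth' : ∀ v, inner ℝ e (X v) = 0 := fun v => by rw [real_inner_comm, horth]
  rw [← sq_eq_sq₀ (LinearMap.normDet_nonneg _) (LinearMap.normDet_nonneg _)]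
  have h1 := LinearMap.normDet_sq_eq_det_gram (appendVec X e)
    ((stdOrthonormalBasis ℝ P).prod (OrthonormalBasis.singleton Unit ℝ))
  have h2 := LinearMap.normDet_sq_eq_det_gram X (stdOrthonormalBasis ℝ P)
  simp only [RCLike.ofReal_real_eq_id, id_eq] at h1 h2
  rw [h1, h2]
  have : Matrix.gram ℝ (fun i => appendVec X e
        (((stdOrthonormalBasis ℝ P).prod (OrthonormalBasis.singleton Unit ℝ)) i)) =
      Matrix.fromBlocks (Matrix.gram ℝ (fun i => X (stdOrthonormalBasis ℝ P i))) 0 0 1 := by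
    ext i j
    rcases i with i | i <;> rcases j with j | j <;>
      simp [Matrix.gram_apply, appendVec_apply, horth, horth', he]
  rw [this, Matrix.det_fromBlocks_zero₂₁, Matrix.det_one, mul_one]

theorem normDet_comp_endomorphism (A : P →ₗ[ℝ] E) (G : E →ₗ[ℝ] E)
    (h : finrank ℝ P = finrank ℝ E) : (G ∘ₗ A).normDet = |LinearMap.det G| * A.normDet := by
  rw [LinearMap.normDet_comp_of_finrank_eq _ _ h, LinearMap.normDet_eq_abs_det]

theorem finrank_withLp_prod_real : finrank ℝ (WithLp 2 (P × ℝ)) = finrank ℝ P + 1 := by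
  rw [(WithLp.linearEquiv 2 ℝ (P × ℝ)).finrank_eq, finrank_prod, finrank_self]

theorem normDet_appendVec (X : P →ₗ[ℝ] E) (u e : E) (he : ‖e‖ = 1)
    (horth : ∀ v, inner ℝ (X v) e = 0) (hdim : finrank ℝ P + 1 = finrank ℝ E) :
    (appendVec X u).normDet = |inner ℝ u e| * X.normDet := by
  have horth' : ∀ v, inner ℝ e (X v) = 0 := fun v => by rw [real_inner_comm, horth]
  -- `G` fixes the range of `X` and sends `e` to `u`. Being a rank-one perturbation of the identity,
  -- it has determinant 1 + ⟨e, u - e⟩ = ⟨u, e⟩.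
  set G : E →ₗ[ℝ] E := LinearMap.id +
    (LinearMap.toSpanSingleton ℝ E (u - e)) ∘ₗ (innerSL ℝ e).toLinearMap with hG
  have h1 : appendVec X u = G ∘ₗ appendVec X e := by
    ext w
    simp only [appendVec_apply, hG, LinearMap.comp_apply, LinearMap.add_apply, LinearMap.id_apply]
    simp [inner_add_right, inner_smul_right, horth', he]
    module
  have h2 : LinearMap.det G = inner ℝ u e := by
    rw [hG, det_id_add_comp_comm, LinearMap.det_ring]
    simp [inner_sub_right, he, real_inner_comm]
  rw [h1, normDet_comp_endomorphism _ _ (finrank_withLp_prod_real.trans hdim), h2,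
    normDet_appendVec_unit_normal X he horth]

/-- The Jacobian of `(y, τ) ↦ x(y) + τ u(y)`, where `X` is the derivative of `x`, `u' ∘ X` that of
`u`, and `S` is the shape operator on the range `T` of `X`. -/
theorem normDet_appendVec_add_smul {T K : Submodule ℝ E} (hc : IsCompl T K) {u : E}
    (hu : u ∈ K) (u' : E →ₗ[ℝ] E) (X : P →ₗ[ℝ] E)
    (hX : ∀ v, X v ∈ T) (hdim : finrank ℝ P + 1 = finrank ℝ E) (τ : ℝ) :
    (appendVec (X + τ • (u' ∘ₗ X)) u).normDet =
      |LinearMap.det (LinearMap.id - τ •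
        (-(T.projectionOnto K hc ∘ₗ u' ∘ₗ T.subtype)))| *
        (appendVec X u).normDet := by
  set π := T.projectionOnto K hc
  -- `G` fixes `u`, since π kills it, and sends X v to X v + τ u' (X v). Swapping the two factors in
  -- its determinant leaves id + τ π u' on `T`, which is id - τ S.
  set G : E →ₗ[ℝ] E := LinearMap.id + (τ • (u' ∘ₗ T.subtype)) ∘ₗ π with hG
  have hu : π u = 0 := by simpa only [π, Submodule.projectionOnto_apply_eq_zero_iff] using hu
  have hπ : ∀ v, π (X v) = ⟨X v, hX v⟩ := fun v =>
    Submodule.projectionOnto_apply_left hc ⟨X v, hX v⟩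
  have h1 : appendVec (X + τ • (u' ∘ₗ X)) u = G ∘ₗ appendVec X u := by
    ext w
    simp [appendVec_apply, hG, hu, hπ]
    abel
  rw [h1, normDet_comp_endomorphism _ _ (finrank_withLp_prod_real.trans hdim), hG,
    det_id_add_comp_comm]
  congr 3
  ext w
  simp

end LinearAlgebra

namespace SkeletalStructure

variable {n : ℕ} (s : SkeletalStructure n)

/-- Termwise integration of the expansion of the determinant; the dimension hypothesis makes both
sums end at j = n. -/
theorem calI_eq_integral {p : Euc (n + 1) × Euc (n + 1)}
    (hn : Module.finrank ℝ (s.baseTangent p) = n) (t : ℝ) :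
    s.calI p t = ∫ τ in (0 : ℝ)..t, LinearMap.det (LinearMap.id - τ • s.radialShape p) := by
  simp_rw [det_id_sub_smul_eq_sum hn (s.radialShape p)]
  rw [intervalIntegral.integral_finsetSum]
  · refine Finset.sum_congr rfl fun j _ => ?_
    rw [intervalIntegral.integral_const_mul, integral_pow]
    simp only [sigma, principalCurvatures]
    simp
    ring
  · intro j _
    exact (by fun_prop : Continuous _).intervalIntegrable _ _

end SkeletalStructure

/-! ### Charts and submanifolds -/

/-- Precomposing with a linear surjection `π` from `E` to `P` gives a map between spaces of equal
dimension with the same image. Its derivative factors through `π`, hence is singular, and the easy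
case of Sard's theorem applies. -/
theorem addHaar_image_eq_zero_of_finrank_lt {P E : Type*} [NormedAddCommGroup P] [NormedSpace ℝ P]
    [FiniteDimensional ℝ P] [NormedAddCommGroup E] [NormedSpace ℝ E] [FiniteDimensional ℝ E]
    [MeasurableSpace E] [BorelSpace E] (μ : Measure E) [μ.IsAddHaarMeasure] {f : P → E} {s : Set P}
    (hf : DifferentiableOn ℝ f s) (hdim : Module.finrank ℝ P < Module.finrank ℝ E) :
    μ (f '' s) = 0 := by
  set k := Module.finrank ℝ E - Module.finrank ℝ P with hk
  have e : E ≃L[ℝ] P × (Fin k → ℝ) := ContinuousLinearEquiv.ofFinrankEq (by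
    rw [Module.finrank_prod, Module.finrank_fin_fun]; omega)
  set π : E →L[ℝ] P := ContinuousLinearMap.fst ℝ P (Fin k → ℝ) ∘L e.toContinuousLinearMap with hπ
  have himg : f '' s = (f ∘ π) '' (π ⁻¹' s) := by
    have hsurj : Function.Surjective π := fun y => ⟨e.symm (y, 0), by simp [hπ]⟩
    rw [image_comp, image_preimage_eq _ hsurj]
  rw [himg]
  refine addHaar_image_eq_zero_of_det_fderivWithin_eq_zero μ
    (f' := fun x => (fderivWithin ℝ f s (π x)) ∘L π) (fun x hx => ?_) (fun x _ => ?_)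
  · exact (hf (π x) hx).hasFDerivWithinAt.comp x π.hasFDerivWithinAt (mapsTo_preimage _ _)
  · rw [ContinuousLinearMap.det, LinearMap.det_eq_zero_iff_ker_ne_bot, Submodule.ne_bot_iff]
    have : 0 < k := by omega
    refine ⟨e.symm (0, fun _ => 1), by simp [hπ], ?_⟩
    rw [Ne, EmbeddingLike.map_eq_zero_iff, Prod.mk_eq_zero]
    exact fun h => one_ne_zero (congrFun h.2 ⟨0, this⟩)

/-- Sigma-compactness passes to continuous images and countable unions, so it yields the
measurability of strata, chart images and closed tubes without any injectivity. -/
theorem _root_.IsSigmaCompact.measurableSet {X : Type*} [TopologicalSpace X] [T2Space X]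
    [MeasurableSpace X] [OpensMeasurableSpace X] {s : Set X} (hs : IsSigmaCompact s) :
    MeasurableSet s := by
  obtain ⟨K, hK, rfl⟩ := hs
  exact MeasurableSet.iUnion fun i => (hK i).measurableSet

theorem _root_.IsOpen.isSigmaCompact {X : Type*} [TopologicalSpace X] [LocallyCompactSpace X]
    [SecondCountableTopology X] {s : Set X} (hs : IsOpen s) :
    IsSigmaCompact s := by
  have : LocallyCompactSpace s := hs.locallyCompactSpace
  rw [isSigmaCompact_iff_sigmaCompactSpace]
  infer_instance

theorem isSigmaCompact_of_subset_iUnion {X ι : Type*} [TopologicalSpace X]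
    {s : Set X} {T : Set ι} (hT : T.Countable) {A : ι → Set X} (hA : ∀ i ∈ T, IsSigmaCompact (A i))
    (h : s = ⋃ i ∈ T, A i) : IsSigmaCompact s := by
  rw [h, biUnion_eq_iUnion]
  have := hT.to_subtype
  exact isSigmaCompact_iUnion _ fun i => hA i i.2

namespace IsChart

variable {F : Type*} [NormedAddCommGroup F] [NormedSpace ℝ F] {k : ℕ} {S : Set F}
  {V : Set (Euc k)} {W : Set F} {g : Euc k → F} {h : F → Euc k}

theorem mem (c : IsChart k S V W g h) {y : Euc k} (hy : y ∈ V) : g y ∈ S ∩ W :=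
  c.image_eq ▸ mem_image_of_mem g hy

theorem contDiffAt (c : IsChart k S V W g h) {y : Euc k} (hy : y ∈ V) : ContDiffAt ℝ ∞ g y :=
  c.contDiffOn.contDiffAt (c.isOpen_source.mem_nhds hy)

theorem differentiableAt (c : IsChart k S V W g h) {y : Euc k} (hy : y ∈ V) :
    DifferentiableAt ℝ g y :=
  (c.contDiffAt hy).differentiableAt (by simp)

theorem contDiffAt_inv (c : IsChart k S V W g h) {p : F} (hp : p ∈ W) : ContDiffAt ℝ ∞ h p :=
  c.contDiffOn_inv.contDiffAt (c.isOpen_target.mem_nhds hp)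

theorem differentiableAt_inv (c : IsChart k S V W g h) {p : F} (hp : p ∈ W) :
    DifferentiableAt ℝ h p :=
  (c.contDiffAt_inv hp).differentiableAt (by simp)

theorem injOn (c : IsChart k S V W g h) : InjOn g V :=
  LeftInvOn.injOn (f₁' := h) c.left_inv

theorem right_inv (c : IsChart k S V W g h) {p : F} (hp : p ∈ S ∩ W) : h p ∈ V ∧ g (h p) = p := by
  rw [← c.image_eq] at hp
  obtain ⟨y, hy, rfl⟩ := hp
  rw [c.left_inv y hy]
  exact ⟨hy, rfl⟩

theorem fderiv_comp_fderiv (c : IsChart k S V W g h) {y : Euc k} (hy : y ∈ V) :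
    fderiv ℝ h (g y) ∘L fderiv ℝ g y = ContinuousLinearMap.id ℝ (Euc k) := by
  have h1 : HasFDerivAt (h ∘ g) (fderiv ℝ h (g y) ∘L fderiv ℝ g y) y :=
    (c.differentiableAt_inv (c.mem hy).2).hasFDerivAt.comp y (c.differentiableAt hy).hasFDerivAt
  have h2 : HasFDerivAt (h ∘ g) (ContinuousLinearMap.id ℝ (Euc k)) y :=
    (hasFDerivAt_id y).congr_of_eventuallyEq
      (by filter_upwards [c.isOpen_source.mem_nhds hy] with z hz using c.left_inv z hz)
  exact h1.unique h2

theorem fderiv_injective (c : IsChart k S V W g h) {y : Euc k} (hy : y ∈ V) :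
    Function.Injective (fderiv ℝ g y) := by
  refine Function.LeftInverse.injective (g := fderiv ℝ h (g y)) fun v => ?_
  simpa using congrArg (fun A => A v) (c.fderiv_comp_fderiv hy)

/-- A chart of a relatively open piece is a chart of the whole. This turns charts of n-dimensional
strata into charts of the regular double, in terms of which the skeletal measure is defined. -/
theorem congr_of_inter_eq (c : IsChart k S V W g h) {S' : Set F} {O : Set F} (hO : IsOpen O)
    (hS : S = S' ∩ O) : IsChart k S' V (W ∩ O) g h where
  isOpen_source := c.isOpen_source
  isOpen_target := c.isOpen_target.inter hO
  contDiffOn := c.contDiffOn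
  contDiffOn_inv := c.contDiffOn_inv.mono inter_subset_left
  image_eq := by rw [c.image_eq, hS, inter_assoc, inter_comm O W]
  left_inv := c.left_inv

theorem isSigmaCompact (c : IsChart k S V W g h) : IsSigmaCompact (S ∩ W) := by
  rw [← c.image_eq]
  exact c.isOpen_source.isSigmaCompact.image_of_continuousOn c.contDiffOn.continuousOn

/-- The range of the derivative of a chart is the tangent space. -/
theorem tangentSpace_eq (c : IsChart k S V W g h) {y : Euc k} (hy : y ∈ V) :
    tangentSpace S (g y) = (fderiv ℝ g y).range := by
  apply le_antisymm
  · refine Submodule.span_le.2 fun v hv => ?_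
    have hg : HasFDerivAt g (fderiv ℝ g y) (h (g y)) := by
      rw [c.left_inv y hy]; exact (c.differentiableAt hy).hasFDerivAt
    -- On `S ∩ W` the map `g ∘ h` is the identity, so its derivative `Dg ∘ Dh` fixes the tangent
    -- cone, which therefore lies in the range of `Dg`.
    have h1 : HasFDerivWithinAt (g ∘ h) (fderiv ℝ g y ∘L fderiv ℝ h (g y)) (S ∩ W) (g y) :=
      (hg.comp (g y) (c.differentiableAt_inv (c.mem hy).2).hasFDerivAt).hasFDerivWithinAt
    have h2 : HasFDerivWithinAt (g ∘ h) (ContinuousLinearMap.id ℝ F) (S ∩ W) (g y) :=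
      (hasFDerivWithinAt_id _ _).congr (fun p hp => (c.right_inv hp).2) (c.right_inv (c.mem hy)).2
    have h3 := h1.unique_on h2
    rw [tangentConeAt_inter_nhds (c.isOpen_target.mem_nhds (c.mem hy).2)] at h3
    exact ⟨fderiv ℝ h (g y) v, by simpa using h3 hv⟩
  · rintro _ ⟨v, rfl⟩
    refine Submodule.subset_span ?_
    have h1 := (c.differentiableAt hy).hasFDerivAt.hasFDerivWithinAt (s := V)
    have h2 : fderiv ℝ g y v ∈ tangentConeAt ℝ (g '' V) (g y) := h1.mapsTo_tangent_cone
      (by rw [tangentConeAt_of_mem_nhds (c.isOpen_source.mem_nhds hy)]; trivial)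
    exact tangentConeAt_mono (by rw [c.image_eq]; exact inter_subset_left) h2

end IsChart

namespace IsSubmanifold

variable {F : Type*} [NormedAddCommGroup F] [NormedSpace ℝ F] [SecondCountableTopology F] {k : ℕ}
  {S : Set F}

theorem exists_countable_charts (hS : IsSubmanifold k S) :
    ∃ (T : Set F) (V : F → Set (Euc k)) (W : F → Set F) (g : F → Euc k → F) (h : F → F → Euc k),
      T.Countable ∧ (∀ p ∈ T, IsChart k S (V p) (W p) (g p) (h p)) ∧ S ⊆ ⋃ p ∈ T, W p := by
  choose! V W g h hc using hS
  obtain ⟨T, hTS, hT, hcov⟩ := TopologicalSpace.countable_cover_nhdsWithin (s := S) (f := W)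
    fun p hp => mem_nhdsWithin_of_mem_nhds ((hc p hp).1.isOpen_target.mem_nhds (hc p hp).2)
  exact ⟨T, V, W, g, h, hT, fun p hp => (hc p (hTS hp)).1, hcov⟩

theorem isSigmaCompact (hS : IsSubmanifold k S) : IsSigmaCompact S := by
  obtain ⟨T, V, W, g, h, hT, hc, hcov⟩ := hS.exists_countable_charts
  refine isSigmaCompact_of_subset_iUnion hT (fun p hp => (hc p hp).isSigmaCompact) ?_
  rw [← inter_iUnion₂, inter_eq_left.2 hcov]

/-- A countable atlas reduces nullity to one chart. The family `f` lets the same reduction serve for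
endpoints, whole lines and fibres of a parametrization. -/
theorem measure_biUnion_eq_zero (hS : IsSubmanifold k S) {X : Type*} [MeasurableSpace X]
    (μ : Measure X) (f : F → Set X)
    (h0 : ∀ V W g h, IsChart k S V W g h → μ (⋃ p ∈ S ∩ W, f p) = 0) : μ (⋃ p ∈ S, f p) = 0 := by
  obtain ⟨T, V, W, g, h, hT, hc, hcov⟩ := hS.exists_countable_charts
  refine measure_mono_null (iUnion₂_subset fun p hp => ?_)
    ((measure_biUnion_null_iff hT).2 fun q hq => h0 _ _ _ _ (hc q hq))
  obtain ⟨q, hq, hpq⟩ := mem_iUnion₂.1 (hcov hp)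
  exact subset_iUnion₂_of_subset q hq (subset_biUnion_of_mem (u := f) ⟨hp, hpq⟩)

end IsSubmanifold

/-! ### Local structure of a skeletal structure at regular points -/

/-- A stratum of maximal dimension is open in the stratified set. -/
theorem Stratification.exists_isOpen_inter_eq {F : Type*} [NormedAddCommGroup F] [NormedSpace ℝ F]
    {X : Set F} (st : Stratification X) {S : Set F} (hS : S ∈ st.strata)
    (hdim : ∀ T ∈ st.strata, T.Nonempty → st.dim T ≤ st.dim S) : ∃ O, IsOpen O ∧ S = X ∩ O := by
  -- The open set is the complement of the closures of the other strata. If `S` met the closure of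
  -- some `T`, the frontier axiom would give `T` a larger dimension. Empty strata carry an arbitrary
  -- dimension, hence the nonemptiness in the hypothesis.
  refine ⟨(⋃ T ∈ st.strata \ {S}, closure T)ᶜ,
    ((st.finite.subset sdiff_subset).isClosed_biUnion fun _ _ => isClosed_closure).isOpen_compl,
    Subset.antisymm (fun p hp => ⟨st.sUnion_eq ▸ mem_sUnion_of_mem hp hS, fun hp' => ?_⟩) ?_⟩
  · obtain ⟨T, ⟨hT, hne⟩, hpT⟩ := mem_iUnion₂.1 hp'
    have h1 := (st.frontier S hS T hT (fun h => hne h.symm) ⟨p, hp, hpT⟩).2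
    have h2 := hdim T hT (closure_nonempty_iff.1 ⟨p, hpT⟩)
    omega
  · rintro p ⟨hpX, hp⟩
    rw [← st.sUnion_eq] at hpX
    obtain ⟨T, hT, hpT⟩ := hpX
    by_contra hpS
    exact hp (mem_iUnion₂.2 ⟨T, ⟨hT, fun h => hpS (h ▸ hpT)⟩, subset_closure hpT⟩)

theorem norm_smul_unitVec {d : ℕ} {p : Euc d × Euc d} (hp : p.2 ≠ 0) :
    ‖p.2‖ • unitVec p = p.2 := by
  rw [unitVec, smul_smul, mul_inv_cancel₀ (norm_ne_zero_iff.2 hp), one_smul]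

theorem contDiffAt_unitVec {d : ℕ} {p : Euc d × Euc d} (hp : p.2 ≠ 0) :
    ContDiffAt ℝ ∞ (unitVec (d := d)) p := by
  unfold unitVec
  exact ((contDiffAt_snd.norm ℝ hp).inv (norm_ne_zero_iff.2 hp)).smul contDiffAt_snd

namespace SkeletalStructure

variable {n : ℕ} (s : SkeletalStructure n)

theorem exists_isOpen_inter_eq_of_dim_eq {R : Set (Euc (n + 1))} (hR : R ∈ s.strat.strata)
    (hd : s.strat.dim R = n) : ∃ O, IsOpen O ∧ R = s.carrier ∩ O :=
  s.strat.exists_isOpen_inter_eq hR fun T hT _ => (s.dim_le T hT).trans hd.ge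

theorem fst_mem_carrier {p : Euc (n + 1) × Euc (n + 1)} (hp : p ∈ s.double) : p.1 ∈ s.carrier :=
  s.fst_image_double ▸ mem_image_of_mem Prod.fst hp

theorem finrank_tangentSpace {x : Euc (n + 1)} (hx : x ∈ s.reg) :
    Module.finrank ℝ (tangentSpace s.carrier x) = n := by
  obtain ⟨R, ⟨hR, hd⟩, hxR⟩ := hx
  obtain ⟨O, hO, hRO⟩ := s.exists_isOpen_inter_eq_of_dim_eq hR hd
  have hsm := s.strat.smooth R hR
  rw [hd] at hsm
  obtain ⟨V, W, g, h, c, hxW⟩ := hsm x hxR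
  have hy := c.right_inv ⟨hxR, hxW⟩
  have := (c.congr_of_inter_eq hO hRO).tangentSpace_eq hy.1
  rw [hy.2] at this
  rw [this, LinearMap.finrank_range_of_inj (c.fderiv_injective hy.1), finrank_euclideanSpace_fin]

variable {s}

/-- The choice is legitimate because the vector at `p` is one of the two smooth values at its base
point. -/
theorem smoothValue_spec {p : Euc (n + 1) × Euc (n + 1)} (hp : p ∈ s.doubleReg) :
    IsSmoothValue s.carrier s.double p.1 (s.smoothValue p) ∧ s.smoothValue p p.1 = p.2 := by
  refine Classical.epsilon_spec (p := fun f => IsSmoothValue s.carrier s.double p.1 f ∧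
    f p.1 = p.2) ?_
  obtain ⟨f₁, f₂, h₁, h₂, hfib, -⟩ := s.two_sided p.1 hp.2
  have := hfib.self_of_nhdsWithin (s.fst_mem_carrier hp.1)
  have hp2 : p.2 ∈ {v | (p.1, v) ∈ s.double} := hp.1
  rw [this] at hp2
  rcases hp2 with h | h
  · exact ⟨f₁, h₁, h.symm⟩
  · exact ⟨f₂, h₂, h.symm⟩

theorem snd_notMem_baseTangent {p : Euc (n + 1) × Euc (n + 1)} (hp : p ∈ s.doubleReg) :
    p.2 ∉ s.baseTangent p := by
  intro hmem
  obtain ⟨f₁, f₂, h₁, h₂, hfib, ν, hν, hpos, hneg⟩ := s.two_sided p.1 hp.2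
  have := hfib.self_of_nhdsWithin (s.fst_mem_carrier hp.1)
  have hp2 : p.2 ∈ {v | (p.1, v) ∈ s.double} := hp.1
  have h0 := (Submodule.mem_orthogonal _ _).1 hν _ hmem
  rw [this] at hp2
  rcases hp2 with h | h
  · rw [h] at h0; exact hpos.ne' h0
  · rw [h] at h0; exact hneg.ne h0

/-- Near a regular point, the double is the graph of the smooth value. -/
theorem eventually_snd_eq_smoothValue {p : Euc (n + 1) × Euc (n + 1)} (hp : p ∈ s.doubleReg) :
    ∀ᶠ q in 𝓝[s.double] p, q.2 = s.smoothValue p q.1 := by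
  obtain ⟨⟨hf, hfD⟩, hfp⟩ := smoothValue_spec hp
  set f := s.smoothValue p
  obtain ⟨f₁, f₂, h₁, h₂, hfib, ν, hν, hpos, hneg⟩ := s.two_sided p.1 hp.2
  have hne : f₁ p.1 ≠ f₂ p.1 := fun h => by rw [h] at hpos; exact lt_asymm hpos hneg
  have hfst : Tendsto Prod.fst (𝓝[s.double] p) (𝓝[s.carrier] p.1) :=
    continuous_fst.continuousWithinAt.tendsto_nhdsWithin fun q hq => s.fst_mem_carrier hq
  have hc : ∀ f' : Euc (n + 1) → Euc (n + 1), ContDiffAt ℝ ∞ f' p.1 →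
      Tendsto (fun q : Euc (n + 1) × Euc (n + 1) => f' q.1) (𝓝[s.double] p) (𝓝 (f' p.1)) :=
    fun f' hf' => hf'.continuousAt.tendsto.comp (hfst.mono_right nhdsWithin_le_nhds)
  have hsnd : Tendsto (fun q : Euc (n + 1) × Euc (n + 1) => q.2) (𝓝[s.double] p) (𝓝 p.2) :=
    continuous_snd.continuousAt.tendsto.mono_left nhdsWithin_le_nhds
  -- Here `a` is the branch through `p` and `b` the other one. Near `p` both `q.2` and `f q.1` stay
  -- away from `b` by continuity, so both equal `a`.
  have key : ∀ a b : Euc (n + 1) → Euc (n + 1), ContDiffAt ℝ ∞ b p.1 → a p.1 = p.2 →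
      b p.1 ≠ p.2 → ContDiffAt ℝ ∞ a p.1 →
      (∀ᶠ y in 𝓝[s.carrier] p.1, {v | (y, v) ∈ s.double} = {a y, b y}) →
      ∀ᶠ q in 𝓝[s.double] p, q.2 = f q.1 := by
    intro a b hb hap hbp ha hab
    have hd1 := (hc b hb).sub hsnd |>.eventually_ne (sub_ne_zero.2 hbp)
    have hd2 := (hc b hb).sub (hc f hf) |>.eventually_ne (b₂ := 0)
      (by rw [hfp]; exact sub_ne_zero.2 hbp)
    filter_upwards [hfst.eventually hab, hfst.eventually hfD, hd1, hd2,
      self_mem_nhdsWithin] with q hq1 hq2 hq3 hq4 hq5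
    have e1 : q.2 ∈ {v | (q.1, v) ∈ s.double} := hq5
    have e2 : f q.1 ∈ {v | (q.1, v) ∈ s.double} := hq2
    rw [hq1] at e1 e2
    rcases e1 with e1 | e1
    · rcases e2 with e2 | e2
      · rw [e1, e2]
      · exact absurd (by rw [e2, sub_self]) hq4
    · exact absurd (by rw [e1, sub_self]) hq3
  have hp2 : p.2 ∈ {v | (p.1, v) ∈ s.double} := hp.1
  rw [hfib.self_of_nhdsWithin (s.fst_mem_carrier hp.1)] at hp2
  rcases hp2 with h | h
  · exact key f₁ f₂ h₂.1 h.symm (by rw [h]; exact hne.symm) h₁.1 hfib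
  · exact key f₂ f₁ h₁.1 h.symm (by rw [h]; exact hne) h₂.1
      (hfib.mono fun y hy => by rw [hy, pair_comm])

theorem isCompl_baseTangent {p : Euc (n + 1) × Euc (n + 1)} (hp : p ∈ s.doubleReg) :
    IsCompl (s.baseTangent p) (Submodule.span ℝ {p.2}) := by
  have hp0 : p.2 ≠ 0 := s.ne_zero p hp.1
  have hdis : Disjoint (s.baseTangent p) (Submodule.span ℝ {p.2}) :=
    ((Submodule.disjoint_span_singleton' hp0).2 (snd_notMem_baseTangent hp))
  refine ⟨hdis, codisjoint_iff.2 (Submodule.eq_top_of_disjoint _ _ ?_ hdis)⟩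
  rw [finrank_span_singleton hp0, finrank_euclideanSpace_fin, baseTangent,
    s.finrank_tangentSpace hp.2]

theorem sub_starProjection_unitVec_ne_zero {p : Euc (n + 1) × Euc (n + 1)}
    (hp : p ∈ s.doubleReg) :
    unitVec p - (s.baseTangent p).starProjection (unitVec p) ≠ 0 := by
  intro h
  have h1 : unitVec p ∈ s.baseTangent p := by
    rw [sub_eq_zero.1 h]; exact Submodule.starProjection_apply_mem _ _
  have h2 := (s.baseTangent p).smul_mem ‖p.2‖ h1
  rw [norm_smul_unitVec (s.ne_zero p hp.1)] at h2
  exact snd_notMem_baseTangent hp h2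

theorem norm_unitNormal {p : Euc (n + 1) × Euc (n + 1)} (hp : p ∈ s.doubleReg) :
    ‖s.unitNormal p‖ = 1 := by
  rw [unitNormal, norm_smul, norm_inv, norm_norm,
    inv_mul_cancel₀ (norm_ne_zero_iff.2 (sub_starProjection_unitVec_ne_zero hp))]

theorem inner_unitNormal {p : Euc (n + 1) × Euc (n + 1)} {v : Euc (n + 1)}
    (hv : v ∈ s.baseTangent p) : inner ℝ v (s.unitNormal p) = 0 := by
  rw [unitNormal, inner_smul_right, (Submodule.mem_orthogonal _ _).1
    (Submodule.sub_starProjection_mem_orthogonal _) v hv, mul_zero]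

theorem rho_pos {p : Euc (n + 1) × Euc (n + 1)} (hp : p ∈ s.doubleReg) : 0 < s.rho p := by
  have h0 := sub_starProjection_unitVec_ne_zero hp
  have h1 : s.rho p = inner ℝ (unitVec p - (s.baseTangent p).starProjection (unitVec p))
      (s.unitNormal p) := by
    rw [inner_sub_left, inner_unitNormal (Submodule.starProjection_apply_mem _ _), sub_zero, rho]
  rw [h1, unitNormal, inner_smul_right, real_inner_self_eq_norm_sq]
  positivity

end SkeletalStructure

namespace IsChart

variable {n : ℕ} {s : SkeletalStructure n} {V : Set (Euc n)} {W : Set (Euc (n + 1) × Euc (n + 1))}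
  {g : Euc n → Euc (n + 1) × Euc (n + 1)} {h : Euc (n + 1) × Euc (n + 1) → Euc n}

theorem mem_doubleReg (c : IsChart n s.doubleReg V W g h) {y : Euc n} (hy : y ∈ V) :
    g y ∈ s.doubleReg := (c.mem hy).1

theorem eventually_snd_eq_smoothValue (c : IsChart n s.doubleReg V W g h) {y : Euc n}
    (hy : y ∈ V) : ∀ᶠ z in 𝓝 y, (g z).2 = s.smoothValue (g y) (g z).1 := by
  have h1 : Tendsto g (𝓝 y) (𝓝[s.double] (g y)) := by
    refine tendsto_nhdsWithin_iff.2 ⟨(c.contDiffAt hy).continuousAt, ?_⟩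
    filter_upwards [c.isOpen_source.mem_nhds hy] with z hz using (c.mem_doubleReg hz).1
  exact h1.eventually (SkeletalStructure.eventually_snd_eq_smoothValue (c.mem_doubleReg hy))

theorem hasFDerivAt_base (c : IsChart n s.doubleReg V W g h) {y : Euc n} (hy : y ∈ V) :
    HasFDerivAt (fun z => (g z).1) (ContinuousLinearMap.fst ℝ _ _ ∘L fderiv ℝ g y) y :=
  (c.differentiableAt hy).hasFDerivAt.fst

/-- The second component of `g` is locally a smooth function of the first, so a vector killed by the
derivative of the first component is killed by the derivative of `g`. -/
theorem fderiv_fst_injective (c : IsChart n s.doubleReg V W g h) {y : Euc n} (hy : y ∈ V) :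
    Function.Injective (fderiv ℝ (fun z => (g z).1) y) := by
  have hf := (SkeletalStructure.smoothValue_spec (c.mem_doubleReg hy)).1.1.differentiableAt
    (by simp)
  have h1 := (c.hasFDerivAt_base hy)
  have h2 : HasFDerivAt (fun z => (g z).2) (fderiv ℝ (s.smoothValue (g y)) (g y).1 ∘L
      (ContinuousLinearMap.fst ℝ _ _ ∘L fderiv ℝ g y)) y :=
    (hf.hasFDerivAt.comp y h1).congr_of_eventuallyEq (c.eventually_snd_eq_smoothValue hy)
  have h3 := h2.unique (c.differentiableAt hy).hasFDerivAt.snd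
  rw [h1.fderiv]
  refine (injective_iff_map_eq_zero _).2 fun v hv => ?_
  refine (injective_iff_map_eq_zero _).1 (c.fderiv_injective hy) v (Prod.ext hv ?_)
  have h4 := congrArg (fun A => A v) h3
  simp only [ContinuousLinearMap.comp_apply] at h4 hv
  rw [hv, map_zero] at h4
  exact h4.symm

/-- One inclusion holds because the chart moves inside M; equality is a count of dimensions, both
being n. -/
theorem range_fderiv_fst (c : IsChart n s.doubleReg V W g h) {y : Euc n} (hy : y ∈ V) :
    (fderiv ℝ (fun z => (g z).1) y).range = s.baseTangent (g y) := by
  refine Submodule.eq_of_le_of_finrank_eq ?_ ?_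
  · rintro _ ⟨v, rfl⟩
    refine Submodule.subset_span ?_
    have h1 : fderiv ℝ (fun z => (g z).1) y v ∈ tangentConeAt ℝ ((fun z => (g z).1) '' V) (g y).1 :=
      (c.hasFDerivAt_base hy).differentiableAt.hasFDerivAt.hasFDerivWithinAt.mapsTo_tangent_cone
        (by rw [tangentConeAt_of_mem_nhds (c.isOpen_source.mem_nhds hy)]; trivial)
    refine tangentConeAt_mono ?_ h1
    rintro _ ⟨z, hz, rfl⟩
    exact s.fst_mem_carrier (c.mem_doubleReg hz).1
  · rw [LinearMap.finrank_range_of_inj (c.fderiv_fst_injective hy), finrank_euclideanSpace_fin,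
      SkeletalStructure.baseTangent, s.finrank_tangentSpace (c.mem_doubleReg hy).2]

/-- The derivative of `z ↦ x(z) + τ u(z)` in a chart, as a map on the tangent space of the
parameters `(y, τ)`. -/
def flowDeriv (g : Euc n → Euc (n + 1) × Euc (n + 1)) (y : Euc n) (τ : ℝ) :
    WithLp 2 (Euc n × ℝ) →ₗ[ℝ] Euc (n + 1) :=
  appendVec (fderiv ℝ (fun z => (g z).1) y + τ • fderiv ℝ (fun z => unitVec (g z)) y :
    Euc n →L[ℝ] Euc (n + 1)).toLinearMap (unitVec (g y))

/-- The pointwise heart of the volume formulas: `normDet_appendVec_add_smul` yields the shape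
operator factor and `normDet_appendVec`, applied to the unit normal, yields ρ. -/
theorem normDet_flowDeriv (c : IsChart n s.doubleReg V W g h) {y : Euc n} (hy : y ∈ V) (τ : ℝ) :
    (flowDeriv g y τ).normDet =
      |LinearMap.det (LinearMap.id - τ • s.radialShape (g y))| *
        (s.rho (g y) * (fderiv ℝ (fun z => (g z).1) y).toLinearMap.normDet) := by
  have hp := c.mem_doubleReg hy
  have hp0 : (g y).2 ≠ 0 := s.ne_zero _ hp.1
  obtain ⟨⟨hf, -⟩, hfp⟩ := SkeletalStructure.smoothValue_spec hp
  have hX : ∀ v, fderiv ℝ (fun z => (g z).1) y v ∈ s.baseTangent (g y) := fun v => by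
    rw [← c.range_fderiv_fst hy]; exact ⟨v, rfl⟩
  set X := fderiv ℝ (fun z => (g z).1) y with hXdef
  set U : Euc (n + 1) → Euc (n + 1) := fun x => ‖s.smoothValue (g y) x‖⁻¹ • s.smoothValue (g y) x
    with hU
  have hdU : DifferentiableAt ℝ U (g y).1 := by
    have hf' := hf.differentiableAt (by simp)
    have : s.smoothValue (g y) (g y).1 ≠ 0 := by rw [hfp]; exact hp0
    exact ((hf'.norm ℝ this).inv (norm_ne_zero_iff.2 this)).smul hf'
  -- In the chart the unit field is `U` composed with the base point map, which ties its derivative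
  -- to the ambient derivative in the definition of `S_rad`.
  have hu' : fderiv ℝ (fun z => unitVec (g z)) y = fderiv ℝ U (g y).1 ∘L X := by
    refine HasFDerivAt.fderiv ?_
    refine (hdU.hasFDerivAt.comp y
      (c.hasFDerivAt_base hy).differentiableAt.hasFDerivAt).congr_of_eventuallyEq ?_
    filter_upwards [c.eventually_snd_eq_smoothValue hy] with z hz
    simp only [unitVec, hU, Function.comp_apply, hz]
  have hc := SkeletalStructure.isCompl_baseTangent hp
  have hdim : Module.finrank ℝ (Euc n) + 1 = Module.finrank ℝ (Euc (n + 1)) := by simp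
  have hmem : unitVec (g y) ∈ Submodule.span ℝ {(g y).2} :=
    Submodule.smul_mem _ _ (Submodule.mem_span_singleton_self _)
  have h1 := normDet_appendVec_add_smul hc hmem (fderiv ℝ U (g y).1).toLinearMap
    X.toLinearMap hX hdim τ
  have h2 := normDet_appendVec X.toLinearMap (unitVec (g y)) (s.unitNormal (g y))
    (SkeletalStructure.norm_unitNormal hp)
    (fun v => SkeletalStructure.inner_unitNormal (hX v)) hdim
  have h3 : |inner ℝ (unitVec (g y)) (s.unitNormal (g y))| = s.rho (g y) :=
    abs_of_pos (SkeletalStructure.rho_pos hp)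
  rw [h3] at h2
  rw [← h2, SkeletalStructure.radialShape, dif_pos hc, ← h1, flowDeriv, hu']
  rfl

theorem normDet_flowDeriv_zero (c : IsChart n s.doubleReg V W g h) {y : Euc n} (hy : y ∈ V) :
    (flowDeriv g y 0).normDet =
      s.rho (g y) * (fderiv ℝ (fun z => (g z).1) y).toLinearMap.normDet := by
  rw [c.normDet_flowDeriv hy, zero_smul, sub_zero, LinearMap.det_id, abs_one, one_mul]

theorem normDet_flowDeriv_zero_pos (c : IsChart n s.doubleReg V W g h) {y : Euc n} (hy : y ∈ V) :
    0 < (flowDeriv g y 0).normDet := by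
  rw [c.normDet_flowDeriv_zero hy]
  refine mul_pos (SkeletalStructure.rho_pos (c.mem_doubleReg hy))
    (lt_of_le_of_ne (LinearMap.normDet_nonneg _) (Ne.symm ?_))
  rw [Ne, LinearMap.normDet_eq_zero_iff_ker_ne_bot, not_not, LinearMap.ker_eq_bot]
  exact c.fderiv_fst_injective hy

end IsChart

/-! ### The skeletal measure in charts -/

/-- A supremum of measures is not computed set by set. Instead, `ν` plus the part of the supremum
outside `A` is an upper bound of the family, and restricting it to `A` leaves at most `ν`. -/
theorem restrict_sSup_le {X : Type*} [MeasurableSpace X] {𝓜 : Set (Measure X)} {A : Set X}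
    (hA : MeasurableSet A) {ν : Measure X} (h : ∀ μ ∈ 𝓜, μ.restrict A ≤ ν) :
    (sSup 𝓜).restrict A ≤ ν := by
  have h1 : sSup 𝓜 ≤ ν + (sSup 𝓜).restrict Aᶜ := by
    refine sSup_le fun μ hμ => ?_
    rw [← Measure.restrict_add_restrict_compl (μ := μ) hA]
    exact add_le_add (h μ hμ) (Measure.restrict_mono le_rfl (le_sSup hμ))
  have h2 : (sSup 𝓜).restrict A ≤ (ν + (sSup 𝓜).restrict Aᶜ).restrict A :=
    Measure.restrict_mono le_rfl h1
  rw [Measure.restrict_add, Measure.restrict_restrict hA, inter_compl_self, Measure.restrict_empty,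
    add_zero] at h2
  exact h2.trans Measure.restrict_le_self

namespace SkeletalStructure

variable {n : ℕ} (s : SkeletalStructure n)

theorem ne_zero_of_mem_doubleReg : ∀ p ∈ s.doubleReg, p.2 ≠ 0 := fun p hp => s.ne_zero p hp.1

/-- The density of the skeletal measure in a local parametrization of the double. -/
def chartDensity (g : Euc n → Euc (n + 1) × Euc (n + 1)) (y : Euc n) : ENNReal :=
  ENNReal.ofReal (s.rho (g y) * (fderiv ℝ (fun z => (g z).1) y).toLinearMap.normDet)

/-- The contribution of a local parametrization to the skeletal measure. -/
def chartMeasure (V : Set (Euc n)) (g : Euc n → Euc (n + 1) × Euc (n + 1)) :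
    Measure (Euc (n + 1) × Euc (n + 1)) :=
  ((volume.restrict V).withDensity (s.chartDensity g)).map g

end SkeletalStructure

namespace IsChart

section

variable {F : Type*} [NormedAddCommGroup F] [NormedSpace ℝ F] [MeasurableSpace F] [BorelSpace F]
  {k : ℕ} {S : Set F} {V : Set (Euc k)} {W : Set F} {g : Euc k → F} {h : F → Euc k}

theorem measurableSet_preimage_inter (c : IsChart k S V W g h) {B : Set F} (hB : MeasurableSet B) :
    MeasurableSet (g ⁻¹' B ∩ V) := by
  have h1 : Measurable (V.domRestrict g) :=
    (continuousOn_iff_continuous_domRestrict.1 c.contDiffOn.continuousOn).measurable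
  have h2 := (MeasurableEmbedding.subtype_coe c.isOpen_source.measurableSet).measurableSet_image.2
    (h1 hB)
  convert h2 using 1
  ext y
  simp [and_comm]

theorem aemeasurable (c : IsChart k S V W g h) : AEMeasurable g (volume.restrict V) :=
  c.contDiffOn.continuousOn.aemeasurable c.isOpen_source.measurableSet

end

section

variable {d k : ℕ} {S : Set (Euc d × Euc d)} {V : Set (Euc k)} {W : Set (Euc d × Euc d)}
  {g : Euc k → Euc d × Euc d} {h : Euc d × Euc d → Euc k}

theorem contDiffOn_unitVec (c : IsChart k S V W g h) (hS : ∀ p ∈ S, p.2 ≠ 0) :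
    ContDiffOn ℝ ∞ (fun y => unitVec (g y)) V := fun y hy =>
  ((contDiffAt_unitVec (hS _ (c.mem hy).1)).comp y (c.contDiffAt hy)).contDiffWithinAt

/-- The map `(y, τ) ↦ x(y) + τ u(y)`. -/
def flowMap (g : Euc k → Euc d × Euc d) (z : Euc k × ℝ) : Euc d :=
  (g z.1).1 + z.2 • unitVec (g z.1)

theorem contDiffOn_flowMap (c : IsChart k S V W g h) (hS : ∀ p ∈ S, p.2 ≠ 0) :
    ContDiffOn ℝ ∞ (flowMap g) (V ×ˢ univ) := by
  have hm : MapsTo Prod.fst (V ×ˢ (univ : Set ℝ)) V := fun z hz => hz.1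
  exact (c.contDiffOn.fst.comp contDiffOn_fst hm).add
    (contDiffOn_snd.smul ((c.contDiffOn_unitVec hS).comp contDiffOn_fst hm))

end

variable {n : ℕ} {s : SkeletalStructure n} {V : Set (Euc n)} {W : Set (Euc (n + 1) × Euc (n + 1))}
  {g : Euc n → Euc (n + 1) × Euc (n + 1)} {h : Euc (n + 1) × Euc (n + 1) → Euc n}

/-- The derivative of `flowMap g` at `(y, τ)`. -/
def flowMapDeriv (g : Euc n → Euc (n + 1) × Euc (n + 1)) (y : Euc n) (τ : ℝ) :
    Euc n × ℝ →L[ℝ] Euc (n + 1) :=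
  (fderiv ℝ (fun z => (g z).1) y + τ • fderiv ℝ (fun z => unitVec (g z)) y).coprod
    (ContinuousLinearMap.toSpanSingleton ℝ (unitVec (g y)))

theorem hasFDerivAt_flowMap (c : IsChart n s.doubleReg V W g h) {y : Euc n} (hy : y ∈ V) (τ : ℝ) :
    HasFDerivAt (flowMap g) (flowMapDeriv g y τ) (y, τ) := by
  have h1 : HasFDerivAt (fun z => (g z).1) (fderiv ℝ (fun z => (g z).1) y) (y, τ).1 :=
    (c.hasFDerivAt_base hy).differentiableAt.hasFDerivAt
  have h2 : HasFDerivAt (fun z => unitVec (g z)) (fderiv ℝ (fun z => unitVec (g z)) y) (y, τ).1 :=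
    (((c.contDiffOn_unitVec s.ne_zero_of_mem_doubleReg).contDiffAt (c.isOpen_source.mem_nhds hy)).differentiableAt
      (by simp)).hasFDerivAt
  have h3 := (h1.comp (y, τ) hasFDerivAt_fst).add
    ((hasFDerivAt_snd (p := (y, τ))).smul (h2.comp (y, τ) hasFDerivAt_fst))
  refine h3.congr_fderiv (ContinuousLinearMap.ext fun w => ?_)
  simp [flowMapDeriv]
  abel

/-- An isometry from the space of parameters `(y, τ)`. -/
def paramIsometry (n : ℕ) : WithLp 2 (Euc n × ℝ) ≃ₗᵢ[ℝ] Euc (n + 1) :=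
  (stdOrthonormalBasis ℝ _).equiv (stdOrthonormalBasis ℝ _)
    (finCongr (by rw [finrank_withLp_prod_real]; simp))

/-- The linear coordinates `(y, τ)` on `ℝⁿ⁺¹`. -/
def paramEquiv (n : ℕ) : Euc (n + 1) ≃L[ℝ] Euc n × ℝ :=
  (paramIsometry n).symm.toContinuousLinearEquiv.trans
    (WithLp.prodContinuousLinearEquiv 2 ℝ (Euc n) ℝ)

/-- Composing with an isometry from ℝⁿ⁺¹ makes the derivative an endomorphism, for which the norm
determinant is the |det| of the change of variables formula. -/
theorem normDet_flowDeriv_eq_abs_det (g : Euc n → Euc (n + 1) × Euc (n + 1)) (y : Euc n) (τ : ℝ) :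
    (flowDeriv g y τ).normDet =
      |(flowMapDeriv g y τ ∘L (paramEquiv n : Euc (n + 1) →L[ℝ] Euc n × ℝ)).det| := by
  have h3 : (flowDeriv g y τ).normDet =
      (flowDeriv g y τ ∘ₗ (paramIsometry n).symm.toLinearIsometry.toLinearMap).normDet := by
    rw [LinearMap.normDet_comp_of_finrank_eq _ _ (by rw [finrank_withLp_prod_real]; simp),
      LinearIsometry.normDet_eq_one, mul_one]
  rw [h3, LinearMap.normDet_eq_abs_det, ContinuousLinearMap.det]
  congr 2

/-- The factors ρ and `S_rad` depend on a choice made point by point, so their regularity is not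
visible. The Jacobian is continuous because the flow map is smooth, and later regularity of the
density and of 𝓘 is read off from it. -/
theorem continuousOn_normDet_flowDeriv (c : IsChart n s.doubleReg V W g h) :
    ContinuousOn (fun z : Euc n × ℝ => (flowDeriv g z.1 z.2).normDet) (V ×ˢ univ) := by
  have ho : IsOpen (V ×ˢ (univ : Set ℝ)) := c.isOpen_source.prod isOpen_univ
  have h1 := (c.contDiffOn_flowMap s.ne_zero_of_mem_doubleReg).continuousOn_fderiv_of_isOpen ho (by simp)
  have h2 : ContinuousOn (fun z : Euc n × ℝ => |(fderiv ℝ (flowMap g) z ∘L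
      (paramEquiv n : Euc (n + 1) →L[ℝ] Euc n × ℝ)).det|) (V ×ˢ univ) :=
    (ContinuousLinearMap.continuous_det.comp_continuousOn (h1.clm_comp continuousOn_const)).abs
  refine h2.congr fun z hz => ?_
  dsimp only
  rw [normDet_flowDeriv_eq_abs_det, (c.hasFDerivAt_flowMap hz.1 z.2).fderiv]

theorem chartDensity_eq (c : IsChart n s.doubleReg V W g h) {y : Euc n} (hy : y ∈ V) :
    s.chartDensity g y = ENNReal.ofReal (flowDeriv g y 0).normDet := by
  rw [c.normDet_flowDeriv_zero hy]; rfl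

theorem aemeasurable_chartDensity (c : IsChart n s.doubleReg V W g h) :
    AEMeasurable (s.chartDensity g) (volume.restrict V) := by
  have h1 : ContinuousOn (fun y => ENNReal.ofReal (flowDeriv g y 0).normDet) V :=
    ENNReal.continuous_ofReal.comp_continuousOn (c.continuousOn_normDet_flowDeriv.comp
      (f := fun y => (y, (0 : ℝ))) (by fun_prop) fun y hy => ⟨hy, trivial⟩)
  exact (h1.congr fun y hy => c.chartDensity_eq hy).aemeasurable c.isOpen_source.measurableSet

theorem setLIntegral_chartMeasure (c : IsChart n s.doubleReg V W g h)
    {f : Euc (n + 1) × Euc (n + 1) → ENNReal} (hf : Measurable f)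
    {B : Set (Euc (n + 1) × Euc (n + 1))} (hB : MeasurableSet B) :
    ∫⁻ p in B, f p ∂(s.chartMeasure V g) = ∫⁻ y in g ⁻¹' B ∩ V, s.chartDensity g y * f (g y) := by
  have hg : AEMeasurable g ((volume.restrict V).withDensity (s.chartDensity g)) :=
    c.aemeasurable.mono_ac (withDensity_absolutelyContinuous _ _)
  rw [← lintegral_indicator hB, SkeletalStructure.chartMeasure,
    lintegral_map' (hf.indicator hB).aemeasurable hg]
  change ∫⁻ y, (B.indicator f ∘ g) y ∂_ = _
  rw [lintegral_withDensity_eq_lintegral_mul₀ c.aemeasurable_chartDensity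
      ((hf.indicator hB).comp_aemeasurable c.aemeasurable),
    ← lintegral_indicator c.isOpen_source.measurableSet,
    ← lintegral_indicator (c.measurableSet_preimage_inter hB)]
  congr 1
  ext y
  by_cases h1 : y ∈ V <;> by_cases h2 : g y ∈ B <;> simp [h1, h2, indicator]

theorem chartMeasure_apply (c : IsChart n s.doubleReg V W g h)
    {B : Set (Euc (n + 1) × Euc (n + 1))} (hB : MeasurableSet B) :
    s.chartMeasure V g B = ∫⁻ y in g ⁻¹' B ∩ V, s.chartDensity g y := by
  rw [← setLIntegral_one, c.setLIntegral_chartMeasure measurable_const hB]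
  simp

theorem measurableSet_image (c : IsChart n s.doubleReg V W g h) :
    MeasurableSet (s.doubleReg ∩ W) := c.isSigmaCompact.measurableSet

/-- The measures defined by two local parametrizations agree on the overlap. -/
theorem restrict_chartMeasure_le (c : IsChart n s.doubleReg V W g h) {V' : Set (Euc n)}
    {W' : Set (Euc (n + 1) × Euc (n + 1))} {g' : Euc n → Euc (n + 1) × Euc (n + 1)}
    {h' : Euc (n + 1) × Euc (n + 1) → Euc n} (c' : IsChart n s.doubleReg V' W' g' h') :
    (s.chartMeasure V' g').restrict (s.doubleReg ∩ W) ≤ s.chartMeasure V g := by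
  refine Measure.le_iff.2 fun B hB => ?_
  rw [Measure.restrict_apply hB, c.chartMeasure_apply hB,
    c'.chartMeasure_apply (hB.inter c.measurableSet_image)]
  set C := g' ⁻¹' (B ∩ (s.doubleReg ∩ W)) ∩ V' with hC
  have hCm : MeasurableSet C := c'.measurableSet_preimage_inter (hB.inter c.measurableSet_image)
  -- The transition map; the chain rule multiplies the density by |det Dφ|, the factor that the
  -- change of variables absorbs.
  set φ : Euc n → Euc n := h ∘ g' with hφ
  have hgφ : ∀ y ∈ C, φ y ∈ V ∧ g (φ y) = g' y := fun y hy => c.right_inv hy.1.2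
  have hd : ∀ y ∈ C, HasFDerivAt φ (fderiv ℝ φ y) y := fun y hy =>
    ((c.differentiableAt_inv hy.1.2.2).comp y (c'.differentiableAt hy.2)).hasFDerivAt
  have hinj : InjOn φ C := fun y hy z hz hyz => c'.injOn hy.2 hz.2 (by
    rw [← (hgφ y hy).2, ← (hgφ z hz).2, hyz])
  have hdens : ∀ y ∈ C, s.chartDensity g' y =
      ENNReal.ofReal |(fderiv ℝ φ y).det| * s.chartDensity g (φ y) := by
    intro y hy
    have h1 : HasFDerivAt (fun z => (g' z).1) (fderiv ℝ (fun z => (g z).1) (φ y) ∘L fderiv ℝ φ y)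
        y := by
      refine (((c.hasFDerivAt_base (hgφ y hy).1).differentiableAt.hasFDerivAt).comp y
        (hd y hy)).congr_of_eventuallyEq ?_
      filter_upwards [c'.isOpen_source.mem_nhds hy.2, (c'.contDiffAt hy.2).continuousAt
        (c.isOpen_target.mem_nhds hy.1.2.2)] with z hz1 hz2
      simp only [hφ, Function.comp_apply]
      rw [(c.right_inv ⟨c'.mem_doubleReg hz1, hz2⟩).2]
    rw [SkeletalStructure.chartDensity, h1.fderiv, SkeletalStructure.chartDensity, (hgφ y hy).2,
      ← ENNReal.ofReal_mul (abs_nonneg _), ContinuousLinearMap.toLinearMap_comp,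
      LinearMap.normDet_comp_of_finrank_eq _ _ rfl, LinearMap.normDet_eq_abs_det]
    congr 1
    rw [ContinuousLinearMap.det]
    ring
  calc ∫⁻ y in C, s.chartDensity g' y
      = ∫⁻ y in C, ENNReal.ofReal |(fderiv ℝ φ y).det| * s.chartDensity g (φ y) :=
        setLIntegral_congr_fun hCm hdens
    _ = ∫⁻ y in φ '' C, s.chartDensity g y :=
        (lintegral_image_eq_lintegral_abs_det_fderiv_mul volume hCm
          (fun y hy => (hd y hy).hasFDerivWithinAt) hinj _).symm
    _ ≤ ∫⁻ y in g ⁻¹' B ∩ V, s.chartDensity g y := by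
        refine lintegral_mono_set ?_
        rintro _ ⟨y, hy, rfl⟩
        exact ⟨by rw [mem_preimage, (hgφ y hy).2]; exact hy.1.1, (hgφ y hy).1⟩

/-- Every other chart measure is dominated by this one on its image, so the supremum is too;
conversely this measure is a member of the family and is carried by its image. -/
theorem restrict_skeletalMeasure (c : IsChart n s.doubleReg V W g h) :
    s.skeletalMeasure.restrict (s.doubleReg ∩ W) = s.chartMeasure V g := by
  apply le_antisymm
  · refine restrict_sSup_le c.measurableSet_image ?_
    rintro μ ⟨V', W', g', h', c', rfl⟩
    exact c.restrict_chartMeasure_le c'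
  · have h1 : s.chartMeasure V g ≤ s.skeletalMeasure := le_sSup ⟨V, W, g, h, c, rfl⟩
    refine le_trans (Measure.le_iff.2 fun B hB => ?_) (Measure.restrict_mono le_rfl h1)
    rw [Measure.restrict_apply hB, c.chartMeasure_apply hB,
      c.chartMeasure_apply (hB.inter c.measurableSet_image)]
    exact lintegral_mono_set fun y hy => ⟨⟨hy.1, c.mem hy.2⟩, hy.2⟩

theorem setLIntegral_skeletalMeasure (c : IsChart n s.doubleReg V W g h)
    {f : Euc (n + 1) × Euc (n + 1) → ENNReal} (hf : Measurable f)
    {B : Set (Euc (n + 1) × Euc (n + 1))} (hB : MeasurableSet B) (hBW : B ⊆ s.doubleReg ∩ W) :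
    ∫⁻ p in B, f p ∂s.skeletalMeasure = ∫⁻ y in g ⁻¹' B ∩ V, s.chartDensity g y * f (g y) := by
  rw [← c.setLIntegral_chartMeasure hf hB, ← c.restrict_skeletalMeasure,
    Measure.restrict_restrict hB, inter_eq_left.2 hBW]

end IsChart

/-- Submanifolds of dimension less than `n` have skeletal measure zero. -/
theorem SkeletalStructure.skeletalMeasure_eq_zero_of_dim_lt {n : ℕ} (s : SkeletalStructure n)
    {k : ℕ} (hk : k < n) {S : Set (Euc (n + 1) × Euc (n + 1))} (hS : IsSubmanifold k S) :
    s.skeletalMeasure S = 0 := by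
  have hSm := hS.isSigmaCompact.measurableSet
  rw [← Measure.restrict_eq_zero, ← Measure.nonpos_iff_eq_zero']
  refine restrict_sSup_le hSm ?_
  rintro μ ⟨V, W, g, h, c, rfl⟩
  change (s.chartMeasure V g).restrict S ≤ 0
  rw [Measure.nonpos_iff_eq_zero', Measure.restrict_eq_zero, c.chartMeasure_apply hSm]
  refine setLIntegral_measure_zero _ _ ?_
  -- Seen in the chart, `S` is covered by the images of open sets of ℝᵏ under the smooth maps `h ∘
  -- g'`, which are null since k < n.
  have h1 : g ⁻¹' S ∩ V ⊆ ⋃ p ∈ S, {y ∈ V | g y = p} := fun y hy =>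
    mem_iUnion₂.2 ⟨g y, hy.1, hy.2, rfl⟩
  refine measure_mono_null h1 (hS.measure_biUnion_eq_zero _ _ fun V' W' g' h' c' => ?_)
  have h2 : DifferentiableOn ℝ (h ∘ g') (V' ∩ g' ⁻¹' W) := fun z hz =>
    ((c.differentiableAt_inv hz.2).comp z (c'.differentiableAt hz.1)).differentiableWithinAt
  refine measure_mono_null (iUnion₂_subset fun p hp => ?_)
    (addHaar_image_eq_zero_of_finrank_lt volume h2 (by simpa using hk))
  rintro y ⟨hyV, rfl⟩
  obtain ⟨h3, h4⟩ := c'.right_inv hp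
  exact ⟨h' (g y), ⟨h3, by rw [mem_preimage, h4]; exact (c.mem hyV).2⟩, by
    rw [Function.comp_apply, h4, c.left_inv y hyV]⟩

/-! ### Volumes of tubes -/

theorem measurePreserving_paramEquiv (n : ℕ) : MeasurePreserving (IsChart.paramEquiv n) :=
  (WithLp.volume_preserving_symm_measurableEquiv_toLp_prod (Euc n) ℝ).comp
    (IsChart.paramIsometry n).symm.measurePreserving

theorem _root_.ContinuousOn.measurable_indicator {X Y : Type*} [TopologicalSpace X]
    [MeasurableSpace X] [BorelSpace X] [TopologicalSpace Y] [MeasurableSpace Y] [BorelSpace Y]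
    [Zero Y] {f : X → Y} {A : Set X} (hf : ContinuousOn f A) (hA : MeasurableSet A) :
    Measurable (A.indicator f) := by
  classical
  rw [← piecewise_eq_indicator]
  exact hf.measurable_piecewise continuousOn_const hA

namespace SkeletalStructure

variable {n : ℕ} {s : SkeletalStructure n} {p : Euc (n + 1) × Euc (n + 1)}

theorem finrank_baseTangent (hp : p ∈ s.doubleReg) : Module.finrank ℝ (s.baseTangent p) = n :=
  s.finrank_tangentSpace hp.2

theorem continuous_det_radialShape (hp : p ∈ s.doubleReg) :
    Continuous fun τ : ℝ => LinearMap.det (LinearMap.id - τ • s.radialShape p) := by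
  simp_rw [det_id_sub_smul_eq_sum (finrank_baseTangent hp) (s.radialShape p)]
  fun_prop

theorem calI_sub_calI (hp : p ∈ s.doubleReg) (a b : ℝ) :
    s.calI p b - s.calI p a =
      ∫ τ in a..b, LinearMap.det (LinearMap.id - τ • s.radialShape p) := by
  rw [s.calI_eq_integral (finrank_baseTangent hp),
    s.calI_eq_integral (finrank_baseTangent hp)]
  exact intervalIntegral.integral_interval_sub_left
    ((continuous_det_radialShape hp).intervalIntegrable _ _)
    ((continuous_det_radialShape hp).intervalIntegrable _ _)

end SkeletalStructure

namespace IsChart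

variable {n : ℕ} {s : SkeletalStructure n} {V : Set (Euc n)} {W : Set (Euc (n + 1) × Euc (n + 1))}
  {g : Euc n → Euc (n + 1) × Euc (n + 1)} {h : Euc (n + 1) × Euc (n + 1) → Euc n}

theorem volume_flowMap_image (c : IsChart n s.doubleReg V W g h) {B : Set (Euc n × ℝ)}
    (hB : MeasurableSet B) (hBV : B ⊆ V ×ˢ univ) (hinj : InjOn (flowMap g) B) :
    volume (flowMap g '' B) = ∫⁻ z in B, ENNReal.ofReal (flowDeriv g z.1 z.2).normDet := by
  set e := paramEquiv n
  have hB' : MeasurableSet (e ⁻¹' B) := (measurePreserving_paramEquiv n).measurable hB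
  have h1 : flowMap g '' B = (flowMap g ∘ e) '' (e ⁻¹' B) := by
    rw [image_comp, image_preimage_eq _ e.surjective]
  have h2 : ∀ x ∈ e ⁻¹' B, HasFDerivWithinAt (flowMap g ∘ e)
      (flowMapDeriv g (e x).1 (e x).2 ∘L (e : Euc (n + 1) →L[ℝ] Euc n × ℝ)) (e ⁻¹' B) x :=
    fun x hx => ((c.hasFDerivAt_flowMap (hBV hx).1 (e x).2).comp x
      e.hasFDerivAt).hasFDerivWithinAt
  have h3 : InjOn (flowMap g ∘ e) (e ⁻¹' B) :=
    hinj.comp e.injective.injOn (mapsTo_preimage _ _)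
  rw [h1, ← lintegral_abs_det_fderiv_eq_addHaar_image volume hB' h2 h3,
    ← (measurePreserving_paramEquiv n).setLIntegral_comp_preimage_emb
      e.toHomeomorph.measurableEmbedding]
  refine lintegral_congr fun x => ?_
  rw [normDet_flowDeriv_eq_abs_det]

/-- Positivity removes the absolute value in the Jacobian, so that the polynomial det(I - τ S_rad)
itself is integrated. -/
theorem setLIntegral_normDet_flowDeriv (c : IsChart n s.doubleReg V W g h) {y : Euc n} (hy : y ∈ V)
    {a b : ℝ} (hab : a ≤ b)
    (hpos : ∀ τ ∈ Ioo a b, 0 < LinearMap.det (LinearMap.id - τ • s.radialShape (g y))) :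
    ∫⁻ τ in Ioo a b, ENNReal.ofReal (flowDeriv g y τ).normDet =
      s.chartDensity g y * ENNReal.ofReal (s.calI (g y) b - s.calI (g y) a) := by
  have hp := c.mem_doubleReg hy
  have hcont := SkeletalStructure.continuous_det_radialShape hp
  have h1 : ∀ τ ∈ Ioo a b, ENNReal.ofReal (flowDeriv g y τ).normDet = s.chartDensity g y *
      ENNReal.ofReal (LinearMap.det (LinearMap.id - τ • s.radialShape (g y))) := by
    intro τ hτ
    rw [c.normDet_flowDeriv hy, abs_of_pos (hpos τ hτ), ENNReal.ofReal_mul (hpos τ hτ).le, mul_comm]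
    rfl
  rw [setLIntegral_congr_fun measurableSet_Ioo h1,
    lintegral_const_mul _ (hcont.measurable.ennreal_ofReal),
    SkeletalStructure.calI_sub_calI hp, intervalIntegral.integral_of_le hab,
    integral_Ioc_eq_integral_Ioo, ofReal_integral_eq_lintegral_ofReal]
  · exact (hcont.integrableOn_Icc).mono_set Ioo_subset_Icc_self
  · exact (ae_restrict_iff' measurableSet_Ioo).2 (ae_of_all _ fun τ hτ => (hpos τ hτ).le)

/-- Change of variables, then Tonelli with the τ-integral inside. The image is measurable because it
is an injective continuous image of a Borel set. -/
theorem volume_flowMap_regionBetween (c : IsChart n s.doubleReg V W g h) {C : Set (Euc n)}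
    (hC : MeasurableSet C) (hCV : C ⊆ V) {a b : Euc n → ℝ} (ha : ContinuousOn a V)
    (hb : ContinuousOn b V) (hab : ∀ y ∈ C, a y ≤ b y)
    (hpos : ∀ y ∈ C, ∀ τ ∈ Ioo (a y) (b y),
      0 < LinearMap.det (LinearMap.id - τ • s.radialShape (g y)))
    (hinj : InjOn (flowMap g) (regionBetween a b C)) :
    MeasurableSet (flowMap g '' regionBetween a b C) ∧
    volume (flowMap g '' regionBetween a b C) =
      ∫⁻ y in C, s.chartDensity g y *
        ENNReal.ofReal (s.calI (g y) (b y) - s.calI (g y) (a y)) := by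
  set B := regionBetween a b C with hBdef
  have hVm := c.isOpen_source.measurableSet
  have hB : MeasurableSet B := by
    have h1 : ∀ f : Euc n → ℝ, ContinuousOn f V → Measurable (V.indicator f) := fun f hf =>
      hf.measurable_indicator hVm
    -- The bounds are controlled on `V` only; extending them by zero makes them measurable without
    -- changing the region.
    have h2 : B = regionBetween (V.indicator a) (V.indicator b) C := by
      ext z
      simp only [hBdef, regionBetween, mem_ofPred_eq]
      refine and_congr_right fun hz => ?_
      rw [indicator_of_mem (hCV hz), indicator_of_mem (hCV hz)]
    rw [h2]
    exact measurableSet_regionBetween (h1 a ha) (h1 b hb) hC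
  have hBV : B ⊆ V ×ˢ univ := fun z hz => ⟨hCV hz.1, trivial⟩
  refine ⟨?_, ?_⟩
  · have h0 : IsOpen (V ×ˢ (univ : Set ℝ)) := c.isOpen_source.prod isOpen_univ
    have hcont := ((c.contDiffOn_flowMap s.ne_zero_of_mem_doubleReg).continuousOn).mono hBV
    exact hB.image_of_continuousOn_injOn hcont hinj
  rw [c.volume_flowMap_image hB hBV hinj, ← lintegral_indicator hB, Measure.volume_eq_prod,
    lintegral_prod, ← lintegral_indicator hC]
  · refine lintegral_congr fun y => ?_
    by_cases hy : y ∈ C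
    · rw [indicator_of_mem hy, ← c.setLIntegral_normDet_flowDeriv (hCV hy) (hab y hy) (hpos y hy),
        ← lintegral_indicator measurableSet_Ioo]
      refine lintegral_congr fun τ => ?_
      by_cases hτ : τ ∈ Ioo (a y) (b y)
      · rw [indicator_of_mem hτ, indicator_of_mem (show (y, τ) ∈ B from ⟨hy, hτ⟩)]
      · rw [indicator_of_notMem hτ, indicator_of_notMem fun h : (y, τ) ∈ B => hτ h.2]
    · rw [indicator_of_notMem hy]
      have h0 : ∀ τ, (y, τ) ∉ B := fun τ h => hy h.1
      simp [h0]
  · rw [← Measure.volume_eq_prod, aemeasurable_indicator_iff hB]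
    exact (ENNReal.continuous_ofReal.comp_continuousOn
      (c.continuousOn_normDet_flowDeriv.mono hBV)).aemeasurable hB

/-- The determinant is the quotient of the Jacobians at τ and at 0, which is continuous in (y, τ).
Rescaling τ to [0, 1] turns 𝓘 into a parametric integral over a fixed interval. -/
theorem continuousOn_calI_comp (c : IsChart n s.doubleReg V W g h) {b : Euc n → ℝ}
    (hb : ContinuousOn b V) (hb0 : ∀ y ∈ V, 0 ≤ b y)
    (hpos : ∀ y ∈ V, ∀ τ ∈ Icc 0 (b y),
      0 < LinearMap.det (LinearMap.id - τ • s.radialShape (g y))) :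
    ContinuousOn (fun y => s.calI (g y) (b y)) V := by
  set J : Euc n × ℝ → ℝ := fun z => (flowDeriv g z.1 z.2).normDet with hJ
  have h1 : ∀ y ∈ V, s.calI (g y) (b y) = b y * ∫ τ in (0 : ℝ)..1, J (y, b y * τ) / J (y, 0) := by
    intro y hy
    rw [s.calI_eq_integral (SkeletalStructure.finrank_baseTangent (c.mem_doubleReg hy))]
    have h0 := intervalIntegral.mul_integral_comp_mul_left (a := 0) (b := 1) (c := b y)
      (f := fun τ => LinearMap.det (LinearMap.id - τ • s.radialShape (g y)))
    rw [mul_zero, mul_one] at h0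
    rw [← h0]
    congr 1
    refine intervalIntegral.integral_congr fun τ hτ => ?_
    rw [uIcc_of_le zero_le_one] at hτ
    have hτ' : b y * τ ∈ Icc 0 (b y) :=
      ⟨mul_nonneg (hb0 y hy) hτ.1, mul_le_of_le_one_right (hb0 y hy) hτ.2⟩
    have h2 := c.normDet_flowDeriv_zero hy
    have h3 := c.normDet_flowDeriv_zero_pos hy
    simp only [hJ]
    rw [c.normDet_flowDeriv hy, abs_of_pos (hpos y hy _ hτ'), ← h2, mul_div_cancel_right₀ _ h3.ne']
  refine ContinuousOn.congr ?_ h1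
  refine hb.mul (continuousOn_iff_continuous_domRestrict.2 ?_)
  have hJc : Continuous fun z : V × ℝ => J ((z.1 : Euc n), b z.1 * z.2) / J ((z.1 : Euc n), 0) := by
    have hbV : Continuous fun y : V => b y := continuousOn_iff_continuous_domRestrict.1 hb
    refine Continuous.div ?_ ?_ fun z => (c.normDet_flowDeriv_zero_pos z.1.2).ne'
    · exact c.continuousOn_normDet_flowDeriv.comp_continuous
        (f := fun z : V × ℝ => ((z.1 : Euc n), b z.1 * z.2))
        ((continuous_subtype_val.comp continuous_fst).prodMk
          ((hbV.comp continuous_fst).mul continuous_snd))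
        fun z => ⟨z.1.2, trivial⟩
    · exact c.continuousOn_normDet_flowDeriv.comp_continuous
        (f := fun z : V × ℝ => ((z.1 : Euc n), (0 : ℝ))) (by fun_prop)
        fun z => ⟨z.1.2, trivial⟩
  exact intervalIntegral.continuous_parametric_intervalIntegral_of_continuous' hJc 0 1

end IsChart

/-- The union of the open segments `x + τ u`, `α < τ < β`, over `A`. -/
def tube {d : ℕ} (α β : Euc d × Euc d → ℝ) (A : Set (Euc d × Euc d)) : Set (Euc d) :=
  {z | ∃ p ∈ A, ∃ τ ∈ Ioo (α p) (β p), z = p.1 + τ • unitVec p}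

/-- The union of the closed segments `x + τ u`, `α ≤ τ ≤ β`, over `A`. -/
def closedTube {d : ℕ} (α β : Euc d × Euc d → ℝ) (A : Set (Euc d × Euc d)) : Set (Euc d) :=
  {z | ∃ p ∈ A, ∃ τ ∈ Icc (α p) (β p), z = p.1 + τ • unitVec p}

theorem measurableSet_closedTube {d : ℕ} {α β : Euc d × Euc d → ℝ} {A : Set (Euc d × Euc d)}
    (hA : IsSigmaCompact A) (h0 : ∀ p ∈ A, p.2 ≠ 0) (hα : ContinuousOn α A)
    (hβ : ContinuousOn β A) (hab : ∀ p ∈ A, α p ≤ β p) : MeasurableSet (closedTube α β A) := by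
  obtain ⟨K, hK, rfl⟩ := hA
  -- Interpolating between α and β exhibits the tube over a compact set as a continuous image of `K
  -- k ×ˢ Icc 0 1`.
  have h1 : closedTube α β (⋃ k, K k) = ⋃ k,
      (fun z : (Euc d × Euc d) × ℝ => z.1.1 + (α z.1 + z.2 * (β z.1 - α z.1)) • unitVec z.1) ''
        (K k ×ˢ Icc 0 1) := by
    ext z
    simp only [closedTube, mem_ofPred_eq, mem_iUnion, mem_image]
    constructor
    · rintro ⟨p, ⟨k, hp⟩, τ, hτ, rfl⟩
      have hτ' := hτ
      rw [← segment_eq_Icc (hτ.1.trans hτ.2), segment_eq_image'] at hτ'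
      obtain ⟨θ, hθ, rfl⟩ := hτ'
      exact ⟨k, (p, θ), ⟨hp, hθ⟩, rfl⟩
    · rintro ⟨k, ⟨p, θ⟩, ⟨hp, hθ⟩, rfl⟩
      have hp' := hab p (mem_iUnion.2 ⟨k, hp⟩)
      refine ⟨p, ⟨k, hp⟩, _, ⟨?_, ?_⟩, rfl⟩
      · nlinarith [hθ.1]
      · nlinarith [hθ.2]
  rw [h1]
  refine MeasurableSet.iUnion fun k => (((hK k).prod isCompact_Icc).image_of_continuousOn
    ?_).measurableSet
  have hm : MapsTo Prod.fst (K k ×ˢ Icc (0 : ℝ) 1) (⋃ k, K k) := fun z hz => mem_iUnion.2 ⟨k, hz.1⟩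
  have hu : ContinuousOn (unitVec (d := d)) (⋃ k, K k) := fun p hp =>
    (contDiffAt_unitVec (h0 p hp)).continuousAt.continuousWithinAt
  have hα' := hα.comp continuousOn_fst hm
  have hβ' := hβ.comp continuousOn_fst hm
  exact continuous_fst.fst.continuousOn.add
    ((hα'.add (continuousOn_snd.mul (hβ'.sub hα'))).smul (hu.comp continuousOn_fst hm))

theorem image_flowMap_regionBetween {n : ℕ} {s : SkeletalStructure n} {V : Set (Euc n)}
    {W : Set (Euc (n + 1) × Euc (n + 1))}
    {g : Euc n → Euc (n + 1) × Euc (n + 1)} {h : Euc (n + 1) × Euc (n + 1) → Euc n}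
    (c : IsChart n s.doubleReg V W g h) (α β : Euc (n + 1) × Euc (n + 1) → ℝ)
    {B : Set (Euc (n + 1) × Euc (n + 1))} (hB : B ⊆ s.doubleReg ∩ W) :
    IsChart.flowMap g '' regionBetween (α ∘ g) (β ∘ g) (g ⁻¹' B ∩ V) = tube α β B := by
  ext z
  constructor
  · rintro ⟨⟨y, τ⟩, ⟨hy, hτ⟩, rfl⟩
    exact ⟨g y, hy.1, τ, hτ, rfl⟩
  · rintro ⟨p, hp, τ, hτ, rfl⟩
    obtain ⟨h1, h2⟩ := c.right_inv (hB hp)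
    refine ⟨(h p, τ), ⟨⟨by rwa [mem_preimage, h2], h1⟩, ?_⟩, ?_⟩
    · simpa only [Function.comp_apply, h2] using hτ
    · simp only [IsChart.flowMap, h2]

/-- The segments `x + τ u`, `α < τ < β`, over distinct points of `A` are disjoint. -/
def SegmentsDisjoint {d : ℕ} (α β : Euc d × Euc d → ℝ) (A : Set (Euc d × Euc d)) : Prop :=
  ∀ p ∈ A, ∀ q ∈ A, ∀ τ ∈ Ioo (α p) (β p), ∀ σ ∈ Ioo (α q) (β q),
    p.1 + τ • unitVec p = q.1 + σ • unitVec q → p = q ∧ τ = σ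

namespace SkeletalStructure

variable {n : ℕ} (s : SkeletalStructure n)

/-- The function `𝓘(β) - 𝓘(α)`. -/
def tubeIntegrand (α β : Euc (n + 1) × Euc (n + 1) → ℝ) (p : Euc (n + 1) × Euc (n + 1)) : ℝ :=
  s.calI p (β p) - s.calI p (α p)

variable {s} {A O : Set (Euc (n + 1) × Euc (n + 1))} {α β : Euc (n + 1) × Euc (n + 1) → ℝ}

theorem continuousOn_calI (hA : IsSubmanifold n A) (hO : IsOpen O) (hAO : A = s.doubleReg ∩ O)
    (hβ : ContinuousOn β A) (hβ0 : ∀ p ∈ A, 0 ≤ β p)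
    (hpos : ∀ p ∈ A, ∀ τ ∈ Icc 0 (β p),
      0 < LinearMap.det (LinearMap.id - τ • s.radialShape p)) :
    ContinuousOn (fun p => s.calI p (β p)) A := by
  intro p hp
  obtain ⟨V, W, g, h, c, hpW⟩ := hA p hp
  have hmap : MapsTo g V A := fun y hy => (c.mem hy).1
  have h1 := (c.congr_of_inter_eq hO hAO).continuousOn_calI_comp
    (hβ.comp c.contDiffOn.continuousOn hmap) (fun y hy => hβ0 _ (hmap hy))
    (fun y hy => hpos _ (hmap hy))
  have h2 : ContinuousOn (fun q => s.calI (g (h q)) (β (g (h q)))) (A ∩ W) :=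
    h1.comp (c.contDiffOn_inv.continuousOn.mono inter_subset_right) fun q hq => (c.right_inv hq).1
  have h3 : ContinuousOn (fun p => s.calI p (β p)) (A ∩ W) :=
    h2.congr fun q hq => by simp only [(c.right_inv hq).2]
  exact (h3 p ⟨hp, hpW⟩).mono_of_mem_nhdsWithin
    (inter_mem_nhdsWithin _ (c.isOpen_target.mem_nhds hpW))

/-- Here `f` is a globally measurable stand-in for the integrand, which is known to be regular on
`A` only. -/
theorem volume_tube_of_subset_chart {V : Set (Euc n)} {W : Set (Euc (n + 1) × Euc (n + 1))}
    {g : Euc n → Euc (n + 1) × Euc (n + 1)} {h : Euc (n + 1) × Euc (n + 1) → Euc n}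
    (c : IsChart n A V W g h) (hO : IsOpen O) (hAO : A = s.doubleReg ∩ O)
    (hα : ContinuousOn α A) (hβ : ContinuousOn β A) (hα0 : ∀ p ∈ A, 0 ≤ α p)
    (hab : ∀ p ∈ A, α p ≤ β p)
    (hpos : ∀ p ∈ A, ∀ τ ∈ Icc 0 (β p),
      0 < LinearMap.det (LinearMap.id - τ • s.radialShape p))
    (hinj : SegmentsDisjoint α β A) {f : Euc (n + 1) × Euc (n + 1) → ENNReal} (hf : Measurable f)
    (hfA : ∀ p ∈ A, f p = ENNReal.ofReal (s.tubeIntegrand α β p))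
    {B : Set (Euc (n + 1) × Euc (n + 1))} (hB : MeasurableSet B) (hBW : B ⊆ A ∩ W) :
    MeasurableSet (tube α β B) ∧ volume (tube α β B) = ∫⁻ p in B, f p ∂s.skeletalMeasure := by
  have c' := c.congr_of_inter_eq hO hAO
  have hBW' : B ⊆ s.doubleReg ∩ (W ∩ O) := fun p hp => by
    have h1 := hBW hp
    rw [hAO] at h1
    exact ⟨h1.1.1, h1.2, h1.1.2⟩
  have hmap : MapsTo g V A := fun y hy => (c.mem hy).1
  have hVC : g ⁻¹' B ∩ V ⊆ V := inter_subset_right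
  have h1 := c'.volume_flowMap_regionBetween (c'.measurableSet_preimage_inter hB) hVC
    (hα.comp c.contDiffOn.continuousOn hmap) (hβ.comp c.contDiffOn.continuousOn hmap)
    (fun y hy => hab _ (hmap hy.2))
    (fun y hy τ hτ => hpos _ (hmap hy.2) τ ⟨(hα0 _ (hmap hy.2)).trans hτ.1.le, hτ.2.le⟩) ?_
  · rw [image_flowMap_regionBetween c' α β hBW'] at h1
    refine ⟨h1.1, ?_⟩
    rw [h1.2, c'.setLIntegral_skeletalMeasure hf hB hBW']
    refine setLIntegral_congr_fun (c'.measurableSet_preimage_inter hB) fun y hy => ?_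
    simp only [hfA _ (hmap hy.2)]
    rfl
  · rintro ⟨y, τ⟩ hy ⟨z, σ⟩ hz heq
    obtain ⟨h2, h3⟩ := hinj _ (hmap hy.1.2) _ (hmap hz.1.2) τ hy.2 σ hz.2 heq
    exact Prod.ext (c.injOn hy.1.2 hz.1.2 h2) h3

theorem volume_tube (hA : IsSubmanifold n A) (hO : IsOpen O) (hAO : A = s.doubleReg ∩ O)
    (hα : ContinuousOn α A) (hβ : ContinuousOn β A) (hα0 : ∀ p ∈ A, 0 ≤ α p)
    (hab : ∀ p ∈ A, α p ≤ β p)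
    (hpos : ∀ p ∈ A, ∀ τ ∈ Icc 0 (β p),
      0 < LinearMap.det (LinearMap.id - τ • s.radialShape p))
    (hinj : SegmentsDisjoint α β A) :
    ContinuousOn (s.tubeIntegrand α β) A ∧ volume (tube α β A) =
      ∫⁻ p in A, ENNReal.ofReal (s.tubeIntegrand α β p) ∂s.skeletalMeasure := by
  have hAm : MeasurableSet A := hA.isSigmaCompact.measurableSet
  have hF : ContinuousOn (s.tubeIntegrand α β) A :=
    (continuousOn_calI hA hO hAO hβ (fun p hp => (hα0 p hp).trans (hab p hp)) hpos).sub
      (continuousOn_calI hA hO hAO hα hα0 fun p hp τ hτ =>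
        hpos p hp τ ⟨hτ.1, hτ.2.trans (hab p hp)⟩)
  refine ⟨hF, ?_⟩
  rcases A.eq_empty_or_nonempty with rfl | hne
  · simp [tube]
  set f : Euc (n + 1) × Euc (n + 1) → ENNReal :=
    A.indicator fun p => ENNReal.ofReal (s.tubeIntegrand α β p) with hfdef
  have hf : Measurable f :=
    (ENNReal.continuous_ofReal.comp_continuousOn hF).measurable_indicator hAm
  have hfA : ∀ p ∈ A, f p = ENNReal.ofReal (s.tubeIntegrand α β p) := fun p hp =>
    indicator_of_mem hp _
  obtain ⟨T, V, W, g, h, hT, hc, hcov⟩ := hA.exists_countable_charts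
  have hTne : T.Nonempty := by
    obtain ⟨p, hp⟩ := hne
    obtain ⟨q, hq, -⟩ := mem_iUnion₂.1 (hcov hp)
    exact ⟨q, hq⟩
  obtain ⟨e, rfl⟩ := hT.exists_eq_range hTne
  rw [biUnion_range] at hcov
  -- A countable atlas is cut into disjoint Borel pieces. Disjointness of the segments makes the
  -- tubes over them disjoint, so both sides are countably additive.
  set D : ℕ → Set (Euc (n + 1) × Euc (n + 1)) := fun k => A ∩ disjointed (fun i => W (e i)) k
  have hDm : ∀ k, MeasurableSet (D k) := fun k => hAm.inter
    (MeasurableSet.disjointed (fun i => (hc _ (mem_range_self i)).isOpen_target.measurableSet) k)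
  have hDA : ⋃ k, D k = A := by
    rw [← inter_iUnion, iUnion_disjointed, inter_eq_left.2 hcov]
  have hDdis : Pairwise (Function.onFun Disjoint D) := fun i j hij =>
    (disjoint_disjointed _ hij).mono inter_subset_right inter_subset_right
  have hpiece : ∀ k, MeasurableSet (tube α β (D k)) ∧
      volume (tube α β (D k)) = ∫⁻ p in D k, f p ∂s.skeletalMeasure := fun k =>
    volume_tube_of_subset_chart (hc _ (mem_range_self k)) hO hAO hα hβ hα0 hab hpos hinj hf hfA
      (hDm k) (inter_subset_inter_right _ (disjointed_subset _ k))
  have htube : tube α β A = ⋃ k, tube α β (D k) := by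
    ext z
    simp only [mem_iUnion]
    constructor
    · rintro ⟨p, hp, τ, hτ, rfl⟩
      rw [← hDA] at hp
      obtain ⟨k, hk⟩ := mem_iUnion.1 hp
      exact ⟨k, p, hk, τ, hτ, rfl⟩
    · rintro ⟨k, p, hp, τ, hτ, rfl⟩
      exact ⟨p, hp.1, τ, hτ, rfl⟩
  have htdis : Pairwise (Function.onFun Disjoint fun k => tube α β (D k)) := by
    intro i j hij
    refine Set.disjoint_left.2 ?_
    rintro z ⟨p, hp, τ, hτ, rfl⟩ ⟨q, hq, σ, hσ, heq⟩
    obtain ⟨rfl, -⟩ := hinj p hp.1 q hq.1 τ hτ σ hσ heq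
    exact Set.disjoint_left.1 (hDdis hij) hp hq
  rw [htube, measure_iUnion htdis fun k => (hpiece k).1]
  simp_rw [fun k => (hpiece k).2]
  rw [← lintegral_iUnion hDm hDdis, hDA]
  exact setLIntegral_congr_fun hAm hfA

theorem tubeIntegrand_nonneg {p : Euc (n + 1) × Euc (n + 1)} (hp : p ∈ s.doubleReg)
    (hα0 : 0 ≤ α p) (hab : α p ≤ β p)
    (hpos : ∀ τ ∈ Icc 0 (β p), 0 < LinearMap.det (LinearMap.id - τ • s.radialShape p)) :
    0 ≤ s.tubeIntegrand α β p := by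
  rw [tubeIntegrand, calI_sub_calI hp]
  exact intervalIntegral.integral_nonneg hab fun τ hτ => (hpos τ ⟨hα0.trans hτ.1, hτ.2⟩).le

end SkeletalStructure

theorem volume_endpoints_eq_zero {n : ℕ} {S : Set (Euc (n + 1) × Euc (n + 1))}
    (hS : IsSubmanifold n S) (h0 : ∀ p ∈ S, p.2 ≠ 0) {α : Euc (n + 1) × Euc (n + 1) → ℝ}
    (hα : SmoothAlong n S α) : volume (⋃ p ∈ S, {p.1 + α p • unitVec p}) = 0 := by
  refine hS.measure_biUnion_eq_zero _ _ fun V W g h c => ?_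
  have h1 : DifferentiableOn ℝ (fun y => (g y).1 + α (g y) • unitVec (g y)) V :=
    (c.contDiffOn.fst.add ((hα V W g h c).smul (c.contDiffOn_unitVec h0))).differentiableOn
      (by simp)
  refine measure_mono_null (iUnion₂_subset fun p hp => ?_)
    (addHaar_image_eq_zero_of_finrank_lt volume h1 (by simp))
  rintro z rfl
  obtain ⟨h2, h3⟩ := c.right_inv hp
  exact ⟨h p, h2, by simp only [h3]⟩

/-- Lines over a k-dimensional stratum are parametrized by k + 1 < n + 1 variables. -/
theorem volume_lines_eq_zero {n k : ℕ} (hk : k < n) {S : Set (Euc (n + 1) × Euc (n + 1))}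
    (hS : IsSubmanifold k S) (h0 : ∀ p ∈ S, p.2 ≠ 0) :
    volume (⋃ p ∈ S, range fun τ : ℝ => p.1 + τ • unitVec p) = 0 := by
  refine hS.measure_biUnion_eq_zero _ _ fun V W g h c => ?_
  have h1 : DifferentiableOn ℝ (IsChart.flowMap g) (V ×ˢ univ) :=
    (c.contDiffOn_flowMap h0).differentiableOn (by simp)
  refine measure_mono_null (iUnion₂_subset fun p hp => ?_)
    (addHaar_image_eq_zero_of_finrank_lt volume h1 (by simpa using hk))
  rintro z ⟨τ, rfl⟩
  obtain ⟨h2, h3⟩ := c.right_inv hp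
  exact ⟨(h p, τ), ⟨h2, trivial⟩, by simp only [IsChart.flowMap, h3]⟩

namespace SkeletalStructure

variable {n : ℕ} {s : SkeletalStructure n} {α β : Euc (n + 1) × Euc (n + 1) → ℝ}

theorem hasVolumeIntegral_closedTube (st : Stratification s.double)
    (hdim : ∀ S ∈ st.strata, S.Nonempty → st.dim S ≤ n)
    (hreg : ∀ S ∈ st.strata, st.dim S = n → S ⊆ s.doubleReg)
    (hα : ContinuousOn α s.double) (hβ : ContinuousOn β s.double)
    (hαs : ∀ S ∈ st.strata, st.dim S = n → SmoothAlong n S α)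
    (hβs : ∀ S ∈ st.strata, st.dim S = n → SmoothAlong n S β)
    (hα0 : ∀ p ∈ s.double, 0 ≤ α p) (hab : ∀ p ∈ s.double, α p ≤ β p)
    (hpos : ∀ S ∈ st.strata, st.dim S = n → ∀ p ∈ S, ∀ τ ∈ Icc 0 (β p),
      0 < LinearMap.det (LinearMap.id - τ • s.radialShape p))
    (hinj : SegmentsDisjoint α β s.double)
    {K : Set (Euc (n + 1))} (hK : IsCompact K) (hbdd : closedTube α β s.double ⊆ K)
    {𝒯 : Set (Set (Euc (n + 1) × Euc (n + 1)))} (h𝒯 : 𝒯 ⊆ st.strata) :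
    HasVolumeIntegral (closedTube α β (⋃₀ 𝒯)) (⋃₀ 𝒯) (s.tubeIntegrand α β)
      s.skeletalMeasure := by
  set A := ⋃₀ 𝒯 with hA
  have hAD : A ⊆ s.double := fun p ⟨S, hS, hp⟩ => st.sUnion_eq ▸ mem_sUnion_of_mem hp (h𝒯 hS)
  have h0 : ∀ p ∈ s.double, p.2 ≠ 0 := s.ne_zero
  have hsubD : ∀ S ∈ st.strata, S ⊆ s.double := fun S hS p hp =>
    st.sUnion_eq ▸ mem_sUnion_of_mem hp hS
  -- the part of maximal dimension
  set A' := ⋃₀ {S ∈ 𝒯 | st.dim S = n} with hA'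
  have hA'A : A' ⊆ A := sUnion_subset_sUnion fun S hS => hS.1
  have hA'reg : A' ⊆ s.doubleReg := sUnion_subset fun S hS => hreg S (h𝒯 hS.1) hS.2
  have hopen : ∀ S ∈ {S ∈ 𝒯 | st.dim S = n}, ∃ O, IsOpen O ∧ S = s.double ∩ O := fun S hS =>
    st.exists_isOpen_inter_eq (h𝒯 hS.1) fun T hT hne => (hdim T hT hne).trans hS.2.ge
  choose! O hO hSO using hopen
  have hOo : IsOpen (⋃ S ∈ {S ∈ 𝒯 | st.dim S = n}, O S) := isOpen_biUnion hO
  have hA'O : A' = s.doubleReg ∩ ⋃ S ∈ {S ∈ 𝒯 | st.dim S = n}, O S := by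
    apply Subset.antisymm
    · intro p hp
      refine ⟨hA'reg hp, ?_⟩
      obtain ⟨S, hS, hpS⟩ := hp
      rw [hSO S hS] at hpS
      exact mem_iUnion₂.2 ⟨S, hS, hpS.2⟩
    · rintro p ⟨hpD, hp⟩
      obtain ⟨S, hS, hpO⟩ := mem_iUnion₂.1 hp
      exact ⟨S, hS, by rw [hSO S hS]; exact ⟨hpD.1, hpO⟩⟩
  -- Each n-dimensional stratum is relatively open in the double, so its charts are charts of the
  -- union as well.
  have hA'sub : IsSubmanifold n A' := by
    rintro p ⟨S, hS, hpS⟩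
    have hsm := st.smooth S (h𝒯 hS.1)
    rw [hS.2] at hsm
    obtain ⟨V, W, g, h, c, hpW⟩ := hsm p hpS
    have hSA' : S = A' ∩ O S := by
      apply Subset.antisymm
      · intro q hq
        refine ⟨⟨S, hS, hq⟩, ?_⟩
        rw [hSO S hS] at hq
        exact hq.2
      · rintro q ⟨hq, hqO⟩
        rw [hSO S hS]
        exact ⟨hAD (hA'A hq), hqO⟩
    refine ⟨V, _, g, h, c.congr_of_inter_eq (hO S hS) hSA', hpW, ?_⟩
    rw [hSA'] at hpS
    exact hpS.2
  have hposA' : ∀ p ∈ A', ∀ τ ∈ Icc 0 (β p),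
      0 < LinearMap.det (LinearMap.id - τ • s.radialShape p) := fun p ⟨S, hS, hp⟩ =>
    hpos S (h𝒯 hS.1) hS.2 p hp
  have hA'D := hA'A.trans hAD
  obtain ⟨hFc, hvol⟩ := volume_tube (s := s) hA'sub hOo hA'O (hα.mono hA'D) (hβ.mono hA'D)
    (fun p hp => hα0 p (hA'D hp)) (fun p hp => hab p (hA'D hp)) hposA'
    (fun p hp q hq => hinj p (hA'D hp) q (hA'D hq))
  have hA'm : MeasurableSet A' := hA'sub.isSigmaCompact.measurableSet
  have hlow : ∀ p ∈ A, p ∉ A' → ∃ S ∈ st.strata, st.dim S < n ∧ p ∈ S := by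
    rintro p ⟨S, hS, hp⟩ hp'
    refine ⟨S, h𝒯 hS, lt_of_le_of_ne (hdim S (h𝒯 hS) ⟨p, hp⟩) fun h => hp' ⟨S, ⟨hS, h⟩, hp⟩, hp⟩
  have hnull : s.skeletalMeasure (A \ A') = 0 := by
    have : A \ A' ⊆ ⋃ S ∈ {S ∈ st.strata | st.dim S < n}, S := fun p hp => by
      obtain ⟨S, hS, hd, hpS⟩ := hlow p hp.1 hp.2
      exact mem_iUnion₂.2 ⟨S, ⟨hS, hd⟩, hpS⟩
    refine measure_mono_null this ((measure_biUnion_null_iff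
      (st.finite.subset fun S hS => hS.1).countable).2 fun S hS => ?_)
    exact s.skeletalMeasure_eq_zero_of_dim_lt hS.2 (st.smooth S hS.1)
  have hAA' : A =ᵐ[s.skeletalMeasure] A' := by
    refine (ae_eq_set.2 ⟨hnull, ?_⟩)
    rw [sdiff_eq_empty.2 hA'A, measure_empty]
  -- the region
  have hAσ : IsSigmaCompact A := isSigmaCompact_sUnion _ (st.finite.subset h𝒯).countable
    fun S => (st.smooth S (h𝒯 S.2)).isSigmaCompact
  have hRm : MeasurableSet (closedTube α β A) := measurableSet_closedTube hAσ
    (fun p hp => h0 p (hAD hp)) (hα.mono hAD) (hβ.mono hAD) fun p hp => hab p (hAD hp)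
  have hRK : closedTube α β A ⊆ K := fun z ⟨p, hp, hz⟩ => hbdd ⟨p, hAD hp, hz⟩
  have hRfin : volume (closedTube α β A) < ⊤ := (measure_mono hRK).trans_lt hK.measure_lt_top
  have hRvol : volume (closedTube α β A) = volume (tube α β A') := by
    apply le_antisymm
    -- Besides the open tube there remain the lines over lower strata and the two ends of the
    -- segments over n-dimensional strata, all of volume zero.
    · have hcov : closedTube α β A ⊆ tube α β A' ∪
          ((⋃ S ∈ {S ∈ st.strata | st.dim S < n}, ⋃ p ∈ S, range fun τ : ℝ => p.1 + τ • unitVec p) ∪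
          ((⋃ S ∈ {S ∈ st.strata | st.dim S = n}, ⋃ p ∈ S, {p.1 + α p • unitVec p}) ∪
          (⋃ S ∈ {S ∈ st.strata | st.dim S = n}, ⋃ p ∈ S, {p.1 + β p • unitVec p}))) := by
        rintro z ⟨p, hp, τ, hτ, rfl⟩
        by_cases hpA' : p ∈ A'
        · obtain ⟨S, hS, hpS⟩ := hpA'
          rcases eq_or_lt_of_le hτ.1 with h1 | h1
          · exact Or.inr (Or.inr (Or.inl (mem_iUnion₂.2 ⟨S, ⟨h𝒯 hS.1, hS.2⟩,
              mem_iUnion₂.2 ⟨p, hpS, by rw [h1]; rfl⟩⟩)))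
          rcases eq_or_lt_of_le hτ.2 with h2 | h2
          · exact Or.inr (Or.inr (Or.inr (mem_iUnion₂.2 ⟨S, ⟨h𝒯 hS.1, hS.2⟩,
              mem_iUnion₂.2 ⟨p, hpS, by rw [← h2]; rfl⟩⟩)))
          exact Or.inl ⟨p, ⟨S, hS, hpS⟩, τ, ⟨h1, h2⟩, rfl⟩
        · obtain ⟨S, hS, hd, hpS⟩ := hlow p hp hpA'
          exact Or.inr (Or.inl (mem_iUnion₂.2 ⟨S, ⟨hS, hd⟩, mem_iUnion₂.2 ⟨p, hpS, τ, rfl⟩⟩))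
      have hcount : ∀ P : Set (Euc (n + 1) × Euc (n + 1)) → Prop,
          {S ∈ st.strata | P S}.Countable := fun P => (st.finite.subset fun S hS => hS.1).countable
      refine (measure_mono hcov).trans ((measure_union_le _ _).trans ?_)
      refine (add_le_add_right (le_of_eq ?_) _).trans (add_zero _).le
      refine measure_union_null ?_ (measure_union_null ?_ ?_)
      · exact (measure_biUnion_null_iff (hcount _)).2 fun S hS =>
          volume_lines_eq_zero hS.2 (st.smooth S hS.1) fun p hp => h0 p (hsubD S hS.1 hp)
      · refine (measure_biUnion_null_iff (hcount _)).2 fun S hS => ?_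
        have hsm := st.smooth S hS.1
        rw [hS.2] at hsm
        exact volume_endpoints_eq_zero hsm (fun p hp => h0 p (hsubD S hS.1 hp)) (hαs S hS.1 hS.2)
      · refine (measure_biUnion_null_iff (hcount _)).2 fun S hS => ?_
        have hsm := st.smooth S hS.1
        rw [hS.2] at hsm
        exact volume_endpoints_eq_zero hsm (fun p hp => h0 p (hsubD S hS.1 hp)) (hβs S hS.1 hS.2)
    · exact measure_mono fun z ⟨p, hp, τ, hτ, hz⟩ => ⟨p, hA'A hp, τ, Ioo_subset_Icc_self hτ, hz⟩
  have hnonneg : 0 ≤ᵐ[s.skeletalMeasure.restrict A'] s.tubeIntegrand α β :=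
    (ae_restrict_iff' hA'm).2 (ae_of_all _ fun p hp => tubeIntegrand_nonneg (hA'reg hp)
      (hα0 p (hA'D hp)) (hab p (hA'D hp)) (hposA' p hp))
  have hmeas : AEStronglyMeasurable (s.tubeIntegrand α β) (s.skeletalMeasure.restrict A') :=
    hFc.aestronglyMeasurable hA'm
  -- The integrand is nonnegative on `A'`, so integrability follows from the volume identity and the
  -- finiteness of the volume.
  have hint : IntegrableOn (s.tubeIntegrand α β) A' s.skeletalMeasure := by
    refine ⟨hmeas, ?_⟩
    rw [hasFiniteIntegral_iff_ofReal hnonneg, ← hvol, ← hRvol]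
    exact hRfin
  refine ⟨hRm, hRfin, hint.congr_set_ae hAA', ?_⟩
  rw [setIntegral_congr_set hAA', integral_eq_lintegral_of_nonneg_ae hnonneg hmeas, ← hvol,
    ← hRvol, Measure.real]

end SkeletalStructure

/-! ### Positivity of the Jacobian along the linking flow -/

/-- If `z ↦ Φ(z.1, χ z)` is an immersion at `(y, t)`, then `Φ` is an immersion at `(y, χ(y, t))`. -/
theorem injective_of_injective_fderiv_reparam {P E : Type*} [NormedAddCommGroup P]
    [NormedSpace ℝ P] [FiniteDimensional ℝ P] [NormedAddCommGroup E] [NormedSpace ℝ E]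
    {Φ : P × ℝ → E} {χ : P × ℝ → ℝ} {y : P} {t : ℝ} {A : P × ℝ →L[ℝ] E}
    (hΦ : HasFDerivAt Φ A (y, χ (y, t))) (hχ : DifferentiableAt ℝ χ (y, t))
    (hinj : Function.Injective (fderiv ℝ (fun z : P × ℝ => Φ (z.1, χ z)) (y, t))) :
    Function.Injective A := by
  set B : P × ℝ →L[ℝ] P × ℝ := (ContinuousLinearMap.fst ℝ P ℝ).prod (fderiv ℝ χ (y, t))
  have h1 : HasFDerivAt (fun z : P × ℝ => (z.1, χ z)) B (y, t) :=
    hasFDerivAt_fst.prodMk hχ.hasFDerivAt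
  have h2 : HasFDerivAt (fun z : P × ℝ => Φ (z.1, χ z)) (A ∘L B) (y, t) :=
    HasFDerivAt.comp (g := Φ) (f := fun z : P × ℝ => (z.1, χ z)) (y, t) hΦ h1
  rw [h2.fderiv] at hinj
  -- `A ∘L B` is injective, hence so is `B`. As an endomorphism in finite dimension `B` is then
  -- surjective, and injectivity passes to `A`.
  have hB : Function.Injective B := Function.Injective.of_comp (f := A) hinj
  have hBs : Function.Surjective B := LinearMap.injective_iff_surjective.1 hB
  intro v w hvw
  obtain ⟨v, rfl⟩ := hBs v
  obtain ⟨w, rfl⟩ := hBs w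
  rw [hinj hvw]

namespace IsChart

variable {n : ℕ} {s : SkeletalStructure n} {V : Set (Euc n)} {W : Set (Euc (n + 1) × Euc (n + 1))}
  {g : Euc n → Euc (n + 1) × Euc (n + 1)} {h : Euc (n + 1) × Euc (n + 1) → Euc n}

theorem snd_ne_zero (c : IsChart n s.doubleReg V W g h) {y : Euc n} (hy : y ∈ V) :
    (g y).2 ≠ 0 := s.ne_zero_of_mem_doubleReg _ (c.mem hy).1

theorem det_ne_zero_of_injective (c : IsChart n s.doubleReg V W g h) {y : Euc n} (hy : y ∈ V)
    {τ : ℝ} (hinj : Function.Injective (flowMapDeriv g y τ)) :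
    LinearMap.det (LinearMap.id - τ • s.radialShape (g y)) ≠ 0 := by
  intro h0
  have h1 := c.normDet_flowDeriv hy τ
  rw [h0, abs_zero, zero_mul, LinearMap.normDet_eq_zero_iff_ker_ne_bot] at h1
  refine h1 (LinearMap.ker_eq_bot.2 ?_)
  exact hinj.comp (WithLp.linearEquiv 2 ℝ (Euc n × ℝ)).injective

theorem differentiableAt_norm_snd (c : IsChart n s.doubleReg V W g h) {y : Euc n} (hy : y ∈ V) :
    DifferentiableAt ℝ (fun z => ‖(g z).2‖) y :=
  ((c.differentiableAt hy).snd).norm ℝ (c.snd_ne_zero hy)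

theorem det_ne_zero_of_nonsingular_int (c : IsChart n s.doubleReg V W g h) {y : Euc n} (hy : y ∈ V)
    (hns : ∀ t ∈ Ioc (0 : ℝ) (1 / 2),
      Function.Injective (fderiv ℝ (fun z : Euc n × ℝ => flowInt (g z.1) z.2) (y, t)))
    {τ : ℝ} (hτ : τ ∈ Ioc 0 ‖(g y).2‖) :
    LinearMap.det (LinearMap.id - τ • s.radialShape (g y)) ≠ 0 := by
  refine c.det_ne_zero_of_injective hy ?_
  have hr : 0 < ‖(g y).2‖ := norm_pos_iff.2 (c.snd_ne_zero hy)
  -- The flow time at which the radial flow, at double speed, has covered the distance τ.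
  set t := τ / (2 * ‖(g y).2‖) with ht
  have htI : t ∈ Ioc (0 : ℝ) (1 / 2) := by
    refine ⟨div_pos hτ.1 (by positivity), ?_⟩
    rw [ht, div_le_iff₀ (by positivity)]
    linarith [hτ.2]
  have hχt : 2 * t * ‖(g y).2‖ = τ := by rw [ht]; field_simp
  refine injective_of_injective_fderiv_reparam (Φ := flowMap g) (y := y) (t := t)
    (χ := fun z => 2 * z.2 * ‖(g z.1).2‖) ?_ ?_ (hns t htI)
  · simp only [hχt]
    exact c.hasFDerivAt_flowMap hy τ
  · exact ((differentiableAt_const _).mul differentiableAt_snd).mul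
      (DifferentiableAt.comp (f := Prod.fst) (y, t) (c.differentiableAt_norm_snd hy)
        differentiableAt_fst)

theorem det_ne_zero_of_nonsingular_ext (c : IsChart n s.doubleReg V W g h) {y : Euc n} (hy : y ∈ V)
    {ℓ : Euc (n + 1) × Euc (n + 1) → ℝ} (hℓ : DifferentiableAt ℝ (fun z => ℓ (g z)) y)
    (hlt : ‖(g y).2‖ < ℓ (g y))
    (hns : ∀ t ∈ Icc (1 / 2 : ℝ) 1,
      Function.Injective (fderiv ℝ (fun z : Euc n × ℝ => flowExt ℓ (g z.1) z.2) (y, t)))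
    {τ : ℝ} (hτ : τ ∈ Icc ‖(g y).2‖ (ℓ (g y))) :
    LinearMap.det (LinearMap.id - τ • s.radialShape (g y)) ≠ 0 := by
  refine c.det_ne_zero_of_injective hy ?_
  have hd : 0 < ℓ (g y) - ‖(g y).2‖ := sub_pos.2 hlt
  -- The fraction of the way from r to ℓ. The strict inequality r < ℓ is essential: if they agree,
  -- the flow line is stationary in t.
  set θ := (τ - ‖(g y).2‖) / (ℓ (g y) - ‖(g y).2‖) with hθ
  have hθ0 : 0 ≤ θ := div_nonneg (by linarith [hτ.1]) hd.le
  have hθ1 : θ ≤ 1 := by rw [hθ, div_le_one hd]; linarith [hτ.2]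
  have hθm : θ * (ℓ (g y) - ‖(g y).2‖) = τ - ‖(g y).2‖ := div_mul_cancel₀ _ hd.ne'
  set t := (1 + θ) / 2 with ht
  have htI : t ∈ Icc (1 / 2 : ℝ) 1 := ⟨by linarith, by linarith⟩
  have hχt : 2 * (1 - t) * ‖(g y).2‖ + (2 * t - 1) * ℓ (g y) = τ := by
    rw [ht]; linarith
  refine injective_of_injective_fderiv_reparam (Φ := flowMap g) (y := y) (t := t)
    (χ := fun z => 2 * (1 - z.2) * ‖(g z.1).2‖ + (2 * z.2 - 1) * ℓ (g z.1)) ?_ ?_ (hns t htI)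
  · simp only [hχt]
    exact c.hasFDerivAt_flowMap hy τ
  · have h1 := DifferentiableAt.comp (f := Prod.fst) (y, t) (c.differentiableAt_norm_snd hy)
      differentiableAt_fst
    have h2 := DifferentiableAt.comp (f := Prod.fst) (y, t) hℓ differentiableAt_fst
    have h3 : DifferentiableAt ℝ (Prod.snd : Euc n × ℝ → ℝ) (y, t) := differentiableAt_snd
    exact (((h3.const_sub 1).const_mul 2).mul h1).add (((h3.const_mul 2).sub_const 1).mul h2)

end IsChart

/-- The determinant is a polynomial in τ with value 1 at 0, so by the intermediate value theorem it
cannot reach a nonpositive value without vanishing. -/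
theorem SkeletalStructure.det_pos_of_ne_zero {n : ℕ} {s : SkeletalStructure n}
    {p : Euc (n + 1) × Euc (n + 1)} (hp : p ∈ s.doubleReg) {b : ℝ}
    (hne : ∀ τ ∈ Ioc 0 b, LinearMap.det (LinearMap.id - τ • s.radialShape p) ≠ 0)
    {τ : ℝ} (hτ : τ ∈ Icc 0 b) : 0 < LinearMap.det (LinearMap.id - τ • s.radialShape p) := by
  have h0 : LinearMap.det (LinearMap.id - (0 : ℝ) • s.radialShape p) = 1 := by
    rw [zero_smul, sub_zero, LinearMap.det_id]
  by_contra hle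
  rw [not_lt] at hle
  obtain ⟨σ, hσ, hσ0⟩ := intermediate_value_Icc' hτ.1
    (SkeletalStructure.continuous_det_radialShape hp).continuousOn
    (show (0 : ℝ) ∈ Icc _ _ from ⟨hle, by rw [h0]; exact zero_le_one⟩)
  rcases eq_or_lt_of_le hσ.1 with h | h
  · subst h
    exact one_ne_zero (h0.symm.trans hσ0)
  · exact hne σ ⟨h, hσ.2.trans hτ.2⟩ hσ0

/-! ### Bounded skeletal linking structures -/

namespace BoundedSkeletalLinkingStructure

variable {n m : ℕ} {Ω : MultiRegionConfiguration n m} {Ωt : Set (Euc (n + 1))}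
  (L : BoundedSkeletalLinkingStructure Ω Ωt) (i : Fin m)

theorem subset_double {S : Set (Euc (n + 1) × Euc (n + 1))} (hS : S ∈ (L.refinement i).strata) :
    S ⊆ (L.skel i).double := fun _ hp => (L.refinement i).sUnion_eq ▸ mem_sUnion_of_mem hp hS

/-- A stratum of the refinement lies over a stratum of the skeletal set of at least its
dimension. -/
theorem exists_stratum_of_refinement {S : Set (Euc (n + 1) × Euc (n + 1))}
    (hS : S ∈ (L.refinement i).strata) (hne : S.Nonempty) :
    ∃ R ∈ (L.skel i).strat.strata, Prod.fst '' S ⊆ R ∧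
      (L.refinement i).dim S ≤ (L.skel i).strat.dim R := by
  obtain ⟨R, hR, hSR⟩ := L.refines i S hS
  refine ⟨R, hR, hSR, ?_⟩
  obtain ⟨p, hp⟩ := hne
  obtain ⟨V, W, g, h, c, hpW⟩ := (L.refinement i).smooth S hS p hp
  obtain ⟨V', W', g', h', c', hpW'⟩ :=
    (L.skel i).strat.smooth R hR p.1 (hSR (mem_image_of_mem _ hp))
  obtain ⟨hy, hgy⟩ := c.right_inv ⟨hp, hpW⟩
  obtain ⟨hz, hgz⟩ := c'.right_inv ⟨hSR (mem_image_of_mem _ hp), hpW'⟩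
  set y := h p
  set X := ContinuousLinearMap.fst ℝ (Euc (n + 1)) (Euc (n + 1)) ∘L fderiv ℝ g y with hX
  have hXd : HasFDerivAt (fun z => (g z).1) X y := (c.differentiableAt hy).hasFDerivAt.fst
  -- The stratum projects immersively to M, and the image of its tangent space lies in that of `R`;
  -- comparing ranks compares the dimensions.
  have hXinj : Function.Injective X := by
    refine (injective_iff_map_eq_zero _).2 fun v hv => ?_
    refine (injective_iff_map_eq_zero _).1 (c.fderiv_injective hy) v ?_
    refine L.proj_immersion i S hS p hp _ ?_ hv
    have := c.tangentSpace_eq hy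
    rw [hgy] at this
    rw [this]
    exact ⟨v, rfl⟩
  have hXR : X.range ≤ tangentSpace R p.1 := by
    rintro _ ⟨v, rfl⟩
    refine Submodule.subset_span ?_
    have h1 : X v ∈ tangentConeAt ℝ ((fun z => (g z).1) '' V) (g y).1 :=
      hXd.hasFDerivWithinAt.mapsTo_tangent_cone
        (by rw [tangentConeAt_of_mem_nhds (c.isOpen_source.mem_nhds hy)]; trivial)
    rw [hgy] at h1
    refine tangentConeAt_mono ?_ h1
    rintro _ ⟨z, hz, rfl⟩
    exact hSR (mem_image_of_mem _ (c.mem hz).1)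
  have h2 := c'.tangentSpace_eq hz
  rw [hgz] at h2
  have h3 := Submodule.finrank_mono hXR
  rw [LinearMap.finrank_range_of_inj hXinj, h2,
    LinearMap.finrank_range_of_inj (c'.fderiv_injective hz)] at h3
  simpa using h3

theorem dim_le_of_nonempty {S : Set (Euc (n + 1) × Euc (n + 1))}
    (hS : S ∈ (L.refinement i).strata) (hne : S.Nonempty) : (L.refinement i).dim S ≤ n := by
  obtain ⟨R, hR, -, hd⟩ := L.exists_stratum_of_refinement i hS hne
  exact hd.trans ((L.skel i).dim_le R hR)

theorem subset_doubleReg {S : Set (Euc (n + 1) × Euc (n + 1))} (hS : S ∈ (L.refinement i).strata)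
    (hd : (L.refinement i).dim S = n) : S ⊆ (L.skel i).doubleReg := by
  intro p hp
  obtain ⟨R, hR, hSR, hdR⟩ := L.exists_stratum_of_refinement i hS ⟨p, hp⟩
  exact ⟨L.subset_double i hS hp, R, ⟨hR, le_antisymm ((L.skel i).dim_le R hR) (hd.ge.trans hdR)⟩,
    hSR (mem_image_of_mem _ hp)⟩

/-- Up to τ = r the radial half of the flow is nonsingular. Beyond r the external half is used; on
strata of the other kind ℓ = r, so no such τ exists. -/
theorem det_pos {S : Set (Euc (n + 1) × Euc (n + 1))} (hS : S ∈ (L.refinement i).strata)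
    (hd : (L.refinement i).dim S = n) {p : Euc (n + 1) × Euc (n + 1)} (hp : p ∈ S) {τ : ℝ}
    (hτ : τ ∈ Icc 0 (L.ℓ i p)) :
    0 < LinearMap.det (LinearMap.id - τ • (L.skel i).radialShape p) := by
  have hpreg := L.subset_doubleReg i hS hd hp
  refine SkeletalStructure.det_pos_of_ne_zero hpreg (b := L.ℓ i p) (fun τ hτ => ?_) hτ
  obtain ⟨O, hO, hSO⟩ := (L.refinement i).exists_isOpen_inter_eq hS
    fun T hT hne => (L.dim_le_of_nonempty i hT hne).trans hd.ge
  have hSO' : S = (L.skel i).doubleReg ∩ O := Subset.antisymm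
    (fun q hq => ⟨L.subset_doubleReg i hS hd hq, by rw [hSO] at hq; exact hq.2⟩)
    (fun q hq => by rw [hSO]; exact ⟨hq.1.1, hq.2⟩)
  have hsm := (L.refinement i).smooth S hS
  have hℓ := L.ℓ_smooth i S hS
  have hint := L.nonsingular_int i S hS
  have hext := L.nonsingular_ext i S hS
  rw [hd] at hsm hℓ hint hext
  obtain ⟨V, W, g, h, c, hpW⟩ := hsm p hp
  obtain ⟨hy, hgy⟩ := c.right_inv ⟨hp, hpW⟩
  have c' := c.congr_of_inter_eq hO hSO'
  rw [← hgy] at hτ ⊢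
  by_cases hle : τ ≤ ‖(g (h p)).2‖
  · exact c'.det_ne_zero_of_nonsingular_int hy (fun t ht => hint V W g h c _ hy t ht)
      ⟨hτ.1, hle⟩
  · rw [not_le] at hle
    rcases hext with hext | hext
    · exact c'.det_ne_zero_of_nonsingular_ext hy
        (((hℓ V W g h c).contDiffAt (c.isOpen_source.mem_nhds hy)).differentiableAt (by simp))
        (hle.trans_le hτ.2) (fun t ht => hext.2 V W g h c _ hy t ht) ⟨hle.le, hτ.2⟩
    · have := hext.2 (g (h p)) (c.mem hy).1
      exact absurd hτ.2 (by rw [this]; exact not_le.2 hle)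

theorem segmentsDisjoint {α β : Euc (n + 1) × Euc (n + 1) → ℝ}
    (hα : ∀ p ∈ (L.skel i).double, 0 ≤ α p) (hβ : ∀ p ∈ (L.skel i).double, β p ≤ L.ℓ i p) :
    SegmentsDisjoint α β (L.skel i).double := by
  intro p hp q hq τ hτ σ hσ heq
  exact (L.flow_injective i i p hp q hq τ ⟨(hα p hp).trans_lt hτ.1, hτ.2.trans_le (hβ p hp)⟩
    σ ⟨(hα q hq).trans_lt hσ.1, hσ.2.trans_le (hβ q hq)⟩ heq).2

theorem closedTube_subset {α β : Euc (n + 1) × Euc (n + 1) → ℝ}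
    (hα : ∀ p ∈ (L.skel i).double, 0 ≤ α p) (hβ : ∀ p ∈ (L.skel i).double, β p ≤ L.ℓ i p) :
    closedTube α β (L.skel i).double ⊆ Ωt := by
  rintro z ⟨p, hp, τ, hτ, rfl⟩
  -- Only the endpoint τ = ℓ can leave the interior, and there the flow ends in `Ωt`. This
  -- confinement is the source of finite volume.
  rcases eq_or_lt_of_le (hτ.2.trans (hβ p hp)) with h | h
  · have h1 := L.flow_end i p hp
    rw [linkingFlow, if_neg (by norm_num), flowExt] at h1
    rw [h]
    convert h1 using 3
    ring
  · exact interior_subset (L.flow_interior i p hp τ ⟨(hα p hp).trans hτ.1, h⟩)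

theorem smoothAlong_norm_snd {S : Set (Euc (n + 1) × Euc (n + 1))}
    (hS : S ∈ (L.refinement i).strata) :
    SmoothAlong n S (fun p : Euc (n + 1) × Euc (n + 1) => ‖p.2‖) := fun _ _ _ _ c =>
  c.contDiffOn.snd.norm ℝ fun _ hy => (L.skel i).ne_zero _ (L.subset_double i hS (c.mem hy).1)

theorem smoothAlong_ℓ {S : Set (Euc (n + 1) × Euc (n + 1))} (hS : S ∈ (L.refinement i).strata)
    (hd : (L.refinement i).dim S = n) : SmoothAlong n S (L.ℓ i) := by
  have := L.ℓ_smooth i S hS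
  rwa [hd] at this

theorem innerImage_eq_closedTube {A : Set (Euc (n + 1) × Euc (n + 1))}
    (hA : A ⊆ (L.skel i).double) : L.innerImage i A = closedTube (fun _ => 0) (fun p => ‖p.2‖) A := by
  ext z
  constructor
  · rintro ⟨p, hp, t, ht, rfl⟩
    refine ⟨p, hp, 2 * t * ‖p.2‖, ⟨?_, ?_⟩, ?_⟩
    · exact mul_nonneg (by linarith [ht.1]) (norm_nonneg _)
    · exact mul_le_of_le_one_left (norm_nonneg _) (by linarith [ht.2])
    · rw [linkingFlow, if_pos ht.2, flowInt]
  · rintro ⟨p, hp, τ, hτ, rfl⟩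
    have hr : 0 < ‖p.2‖ := norm_pos_iff.2 ((L.skel i).ne_zero p (hA hp))
    have ht : τ / (2 * ‖p.2‖) ≤ 1 / 2 := by
      rw [div_le_iff₀ (by positivity)]; linarith [hτ.2]
    refine ⟨p, hp, τ / (2 * ‖p.2‖), ⟨div_nonneg hτ.1 (by positivity), ht⟩, ?_⟩
    rw [linkingFlow, if_pos ht, flowInt]
    congr 2
    field_simp

theorem outerImage_eq_closedTube {A : Set (Euc (n + 1) × Euc (n + 1))}
    (hA : A ⊆ (L.skel i).double) : L.outerImage i A = closedTube (fun p => ‖p.2‖) (L.ℓ i) A := by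
  have hflow : ∀ p : Euc (n + 1) × Euc (n + 1), ∀ t ∈ Icc (1 / 2 : ℝ) 1,
      linkingFlow (L.ℓ i) p t =
        p.1 + (2 * (1 - t) * ‖p.2‖ + (2 * t - 1) * L.ℓ i p) • unitVec p := by
    intro p t ht
    rw [linkingFlow]
    -- At t = 1/2 the flow is given by its first branch, which agrees there with the external
    -- formula.
    split_ifs with h
    · rw [le_antisymm h ht.1, flowInt]
      congr 2
      ring
    · rfl
  ext z
  constructor
  · rintro ⟨p, hp, t, ht, rfl⟩
    have hle := L.le_ℓ i p (hA hp)
    refine ⟨p, hp, _, ⟨?_, ?_⟩, hflow p t ht⟩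
    · nlinarith [ht.1]
    · nlinarith [ht.2]
  · rintro ⟨p, hp, τ, hτ, rfl⟩
    have hτ' := hτ
    rw [← segment_eq_Icc (hτ.1.trans hτ.2), segment_eq_image'] at hτ'
    obtain ⟨θ, hθ, rfl⟩ := hτ'
    have ht : (1 + θ) / 2 ∈ Icc (1 / 2 : ℝ) 1 := ⟨by linarith [hθ.1], by linarith [hθ.2]⟩
    refine ⟨p, hp, _, ht, ?_⟩
    rw [hflow p _ ht]
    congr 2
    simp only [smul_eq_mul]
    ring

variable {𝒯 : Set (Set (Euc (n + 1) × Euc (n + 1)))}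

theorem sUnion_subset_double (h𝒯 : 𝒯 ⊆ (L.refinement i).strata) :
    ⋃₀ 𝒯 ⊆ (L.skel i).double := sUnion_subset fun _ hS => L.subset_double i (h𝒯 hS)

theorem hasVolumeIntegral_innerImage (h𝒯 : 𝒯 ⊆ (L.refinement i).strata) :
    HasVolumeIntegral (L.innerImage i (⋃₀ 𝒯)) (⋃₀ 𝒯) (L.innerIntegrand i)
      (L.skel i).skeletalMeasure := by
  -- Every term of 𝓘 carries a positive power of t, so 𝓘(0) = 0.
  have h0 : (L.skel i).tubeIntegrand (fun _ => 0) (fun p => ‖p.2‖) = L.innerIntegrand i := by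
    funext p
    simp [SkeletalStructure.tubeIntegrand, innerIntegrand, SkeletalStructure.calI]
  rw [L.innerImage_eq_closedTube i (L.sUnion_subset_double i h𝒯), ← h0]
  refine SkeletalStructure.hasVolumeIntegral_closedTube (L.refinement i)
    (fun S hS hne => L.dim_le_of_nonempty i hS hne) (fun S hS hd => L.subset_doubleReg i hS hd)
    continuousOn_const continuous_snd.norm.continuousOn
    (fun S hS hd V W g h c => contDiffOn_const) (fun S hS hd => L.smoothAlong_norm_snd i hS)
    (fun p hp => le_rfl) (fun p hp => norm_nonneg _)
    (fun S hS hd p hp τ hτ => L.det_pos i hS hd hp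
      ⟨hτ.1, hτ.2.trans (L.le_ℓ i p (L.subset_double i hS hp))⟩)
    (L.segmentsDisjoint i (fun p hp => le_rfl) (L.le_ℓ i)) L.compact
    (L.closedTube_subset i (fun p hp => le_rfl) (L.le_ℓ i)) h𝒯

theorem hasVolumeIntegral_outerImage (h𝒯 : 𝒯 ⊆ (L.refinement i).strata) :
    HasVolumeIntegral (L.outerImage i (⋃₀ 𝒯)) (⋃₀ 𝒯) (L.outerIntegrand i)
      (L.skel i).skeletalMeasure := by
  rw [L.outerImage_eq_closedTube i (L.sUnion_subset_double i h𝒯)]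
  exact SkeletalStructure.hasVolumeIntegral_closedTube (L.refinement i)
    (fun S hS hne => L.dim_le_of_nonempty i hS hne) (fun S hS hd => L.subset_doubleReg i hS hd)
    continuous_snd.norm.continuousOn (L.ℓ_continuous i)
    (fun S hS hd => L.smoothAlong_norm_snd i hS) (fun S hS hd => L.smoothAlong_ℓ i hS hd)
    (fun p hp => norm_nonneg _) (L.le_ℓ i)
    (fun S hS hd p hp τ hτ => L.det_pos i hS hd hp hτ)
    (L.segmentsDisjoint i (fun p hp => norm_nonneg _) (fun p hp => le_rfl)) L.compact
    (L.closedTube_subset i (fun p hp => norm_nonneg _) (fun p hp => le_rfl)) h𝒯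

theorem region_eq_innerImage : Ω.region i = L.innerImage i (L.skel i).double := by
  rw [L.innerImage_eq_closedTube i Subset.rfl, (L.isFor i).region_eq]
  ext z
  constructor
  · rintro ⟨p, hp, t, ht, rfl⟩
    refine ⟨p, hp, t * ‖p.2‖, ⟨mul_nonneg ht.1 (norm_nonneg _),
      mul_le_of_le_one_left (norm_nonneg _) ht.2⟩, ?_⟩
    rw [mul_smul, norm_smul_unitVec ((L.skel i).ne_zero p hp)]
  · rintro ⟨p, hp, τ, hτ, rfl⟩
    have hr : 0 < ‖p.2‖ := norm_pos_iff.2 ((L.skel i).ne_zero p hp)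
    refine ⟨p, hp, τ / ‖p.2‖, ⟨div_nonneg hτ.1 hr.le, (div_le_one hr).2 hτ.2⟩, ?_⟩
    rw [unitVec, smul_smul, div_eq_mul_inv]

/-- Each stratum is linked to something or unlinked, so nothing is missed. A stratum may be linked
to several regions; hence the Steiner formula comes from all strata at once, not from adding the
pieces. -/
theorem totalNhd_eq_outerImage : L.totalNhd i = L.outerImage i (L.skel i).double := by
  apply Subset.antisymm
  · have hsub : ∀ j, L.linked i j ⊆ (L.skel i).double := fun j =>
      L.sUnion_subset_double i fun S hS => hS.1
    have hsub' : L.unlinked i ⊆ (L.skel i).double := L.sUnion_subset_double i fun S hS => hS.1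
    refine union_subset (union_subset (iUnion₂_subset fun j _ => ?_) ?_) ?_
    · exact fun z ⟨p, hp, hz⟩ => ⟨p, hsub j hp, hz⟩
    · exact fun z ⟨p, hp, hz⟩ => ⟨p, hsub i hp, hz⟩
    · exact fun z ⟨p, hp, hz⟩ => ⟨p, hsub' hp, hz⟩
  · rintro z ⟨p, hp, hz⟩
    rw [← (L.refinement i).sUnion_eq] at hp
    obtain ⟨S, hS, hpS⟩ := hp
    by_cases h : ∀ j, ∀ T ∈ (L.refinement j).strata, ¬ L.LinkedStrata i S j T
    · exact Or.inr ⟨p, ⟨S, ⟨hS, h⟩, hpS⟩, hz⟩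
    · push Not at h
      obtain ⟨j, T, hT, hST⟩ := h
      have hpj : p ∈ L.linked i j := ⟨S, ⟨hS, T, hT, hST⟩, hpS⟩
      by_cases hij : j = i
      · subst hij
        exact Or.inl (Or.inr ⟨p, hpj, hz⟩)
      · exact Or.inl (Or.inl (mem_iUnion₂.2 ⟨j, hij, p, hpj, hz⟩))

end BoundedSkeletalLinkingStructure

end SkeletalLinking

end

/-! ### The volume formulas, with the generalized Weyl and Steiner formulas -/

theorem mainTheorem12 {n m : ℕ} (Ω : SkeletalLinking.MultiRegionConfiguration n m)
    (Ωt : Set (SkeletalLinking.Euc (n + 1)))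
    (L : SkeletalLinking.BoundedSkeletalLinkingStructure Ω Ωt) :
    (∀ i, ∀ p ∈ (L.skel i).doubleReg, ∀ t : ℝ,
      (L.skel i).calI p t
        = ∫ τ in (0 : ℝ)..t, LinearMap.det (LinearMap.id - τ • (L.skel i).radialShape p)) ∧
    (∀ i j,
      SkeletalLinking.HasVolumeIntegral (L.linkingNhd i j) (L.linked i j)
        (L.outerIntegrand i) (L.skel i).skeletalMeasure ∧
      SkeletalLinking.HasVolumeIntegral (L.linkedRegion i j) (L.linked i j)
        (L.innerIntegrand i) (L.skel i).skeletalMeasure) ∧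
    (∀ i,
      SkeletalLinking.HasVolumeIntegral (L.unlinkedNhd i) (L.unlinked i)
        (L.outerIntegrand i) (L.skel i).skeletalMeasure ∧
      SkeletalLinking.HasVolumeIntegral (L.unlinkedRegion i) (L.unlinked i)
        (L.innerIntegrand i) (L.skel i).skeletalMeasure) ∧
    (∀ i, SkeletalLinking.HasVolumeIntegral (Ω.region i) (L.skel i).double
      (L.innerIntegrand i) (L.skel i).skeletalMeasure) ∧
    (∀ i, SkeletalLinking.HasVolumeIntegral (L.totalNhd i) (L.skel i).double
      (L.outerIntegrand i) (L.skel i).skeletalMeasure) := by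
  refine ⟨fun i p hp t => (L.skel i).calI_eq_integral
    (SkeletalLinking.SkeletalStructure.finrank_baseTangent hp) t, fun i j => ?_, fun i => ?_,
    fun i => ?_, fun i => ?_⟩
  · exact ⟨L.hasVolumeIntegral_outerImage i fun S hS => hS.1,
      L.hasVolumeIntegral_innerImage i fun S hS => hS.1⟩
  · exact ⟨L.hasVolumeIntegral_outerImage i fun S hS => hS.1,
      L.hasVolumeIntegral_innerImage i fun S hS => hS.1⟩
  -- The double is the union of all strata of its refinement, so the general statement applies with
  -- the full family.
  · rw [L.region_eq_innerImage, ← (L.refinement i).sUnion_eq]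
    exact L.hasVolumeIntegral_innerImage i Subset.rfl
  · rw [L.totalNhd_eq_outerImage, ← (L.refinement i).sUnion_eq]
    exact L.hasVolumeIntegral_outerImage i Subset.rfl
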